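/- For $k\ge 1$ let $\Delta_k$ be the set of probability distributions on $[k]=\{1,\dots,k\}$. For $q,p\in\Delta_k$ let $D_q(p)=\sum_{i\in[k]}|p_i-q_i|$ and let $S_p=|\{i: p_i>0\}|$. For an estimator $\hat D:[k]^n\to\mathbb R$ let $$L(\hat D,p,n)=\mathbb E_{X^n\sim p}\bigl|\hat D(X^n)-D_q(p)\bigr|$$ be its mean absolute error on $n$ independent samples $X^n$ from $p$. The empirical estimator is $\hat D^E(X^m)=\sum_{i\in[k]}\bigl|\tfrac{N_i}{m}-q_i\bigr|$, where $N_i$ is the number of times $i$ appears in $X^m$ (for $m=0$, $N_i/m$ is read as $0$). There is an absolute constant $c>0$ such that the following holds. For every $k\ge1$, every $q\in\Delta_k$, every $\varepsilon\in(0,1]$ and every integer $n\ge 1$, with $m$ denoting the real number $\varepsilon^2 n\log n$ rounded to an integer (either down or up), there is an estimator $\hat D:[k]^n\to\mathbb R$ (which may depend on $k,q,\varepsilon,n,m$ but not on $p$) such that for all $p\in\Delta_k$ $$L(\hat D,p,n)\le L(\hat D^E,p,m)+c\cdot\min\Bigl\{\varepsilon,\ \sqrt{\tfrac{S_p}{n}}+\tfrac1{n^{0.49}}\Bigr\}.$$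 -/

import Mathlib

namespace L1Amp

open scoped BigOperators

/-- The number of occurrences `N_i` of the symbol `i` in the sample sequence `x`. -/
def count {k n : ℕ} (x : Fin n → Fin k) (i : Fin k) : ℕ :=
  (Finset.univ.filter (fun j => x j = i)).card

/-- The empirical frequencies `N_i / n`. For the empty sequence (`n = 0`) all of them are `0`. -/
noncomputable def empiricalFreq {k n : ℕ} (x : Fin n → Fin k) (i : Fin k) : ℝ :=
  (count x i : ℝ) / (n : ℝ)

/-- The `ℓ₁`-distance `D_q(p) = ∑ i, |p i - q i|`. -/
noncomputable def l1Dist {k : ℕ} (q p : Fin k → ℝ) : ℝ :=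
  ∑ i, |p i - q i|

/-- The empirical plug-in estimator `∑ i, |N_i / n - q i|` of the `ℓ₁`-distance to `q`. -/
noncomputable def l1Empirical {k : ℕ} (q : Fin k → ℝ) (n : ℕ) (x : Fin n → Fin k) : ℝ :=
  l1Dist q (empiricalFreq x)

/-- The support size `S_p`. -/
noncomputable def supportSize {k : ℕ} (p : Fin k → ℝ) : ℕ :=
  Set.ncard {i : Fin k | 0 < p i}

/-- The mean absolute error of the estimator `Fhat` of `F p` when the argument of `Fhat` is a
sequence of `n` independent samples from `p`: a sequence `x` has probability `∏ j, p (x j)`. -/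
noncomputable def mae {k n : ℕ} (Fhat : (Fin n → Fin k) → ℝ) (F : (Fin k → ℝ) → ℝ)
    (p : Fin k → ℝ) : ℝ :=
  ∑ x : Fin n → Fin k, (∏ j, p (x j)) * |Fhat x - F p|

end L1Amp

namespace L1Amp

/-! By Jensen, the mean absolute error of the empirical estimator on `m` samples is at least the
distance of its mean, `∑ i, bern m (q i) (p i)`, from `D_q(p)`. So it suffices to build, from `n`
samples, a statistic with small fluctuations whose mean is close to that sum
(`mae_le_mae_l1Empirical_add`).

Each term is a Bernstein polynomial of `|x - q|`. Its derivative is a binomial expectation of a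
function bounded by 1. The Hellinger distance between binomial laws therefore makes it Lipschitz in
`√x`, with constant of order `√m` (`abs_binE_sub_le`). On `[0, K / a]`, with `a` about `n / 2` and
`K` of order `log n`, Jackson's theorem in degree of order `log n` (`exists_jackson_polynomial`)
approximates the derivative within `O(ε)`, precisely because `m` is about `ε ^ 2 * n * log n`.
Integration gives a polynomial within `O(ε * p)` of `bern m q`. It has an unbiased estimator, whose
coefficients are only a small power of `n`. Truncated at large counts, it yields a correction `v` of
size at most `n ^ (-0.99)` (`exists_correction`).

When `a * p` exceeds `1 / ε ^ 2`, the uncorrected bias `√(p / a)` is smaller than `ε * p`, so the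
correction should be off. A second independent block of samples makes that decision: `v` is added
only for symbols seen there at most `1 / ε ^ 2` times (`abs_mixture_le`). The error per symbol is
then of order `min (ε * p) (√(p / a))`, up to `n ^ (-0.49) * p`. Summing, with Cauchy–Schwarz over
the support, gives the minimum in the theorem; bounded differences give fluctuations of order `n ^
(-0.49)`. If `m ≤ n` a prefix of the sample suffices, and if `log n` is bounded a constant estimator
does. -/

open Finset

/-! ### Binomial expectations and factorial moments -/

/-- The expectation of `φ N` for a binomial variable `N` with parameters `n` and `p`. -/
noncomputable def binE : ℕ → ℝ → (ℕ → ℝ) → ℝ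
  | 0, _, φ => φ 0
  | n + 1, p, φ => p * binE n p (fun j => φ (j + 1)) + (1 - p) * binE n p φ

theorem binE_zero (p : ℝ) (φ : ℕ → ℝ) : binE 0 p φ = φ 0 := rfl

theorem binE_succ (n : ℕ) (p : ℝ) (φ : ℕ → ℝ) :
    binE (n + 1) p φ = p * binE n p (fun j => φ (j + 1)) + (1 - p) * binE n p φ := rfl

theorem binE_const (n : ℕ) (p c : ℝ) : binE n p (fun _ => c) = c := by
  induction n with
  | zero => rfl
  | succ n ih => rw [binE_succ, ih]; ring

theorem binE_add (n : ℕ) (p : ℝ) (φ ψ : ℕ → ℝ) :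
    binE n p (fun j => φ j + ψ j) = binE n p φ + binE n p ψ := by
  induction n generalizing φ ψ with
  | zero => rfl
  | succ n ih => simp only [binE_succ, ih]; ring

theorem binE_const_mul (n : ℕ) (p c : ℝ) (φ : ℕ → ℝ) :
    binE n p (fun j => c * φ j) = c * binE n p φ := by
  induction n generalizing φ with
  | zero => rfl
  | succ n ih => simp only [binE_succ, ih]; ring

theorem binE_sub (n : ℕ) (p : ℝ) (φ ψ : ℕ → ℝ) :
    binE n p (fun j => φ j - ψ j) = binE n p φ - binE n p ψ := by
  induction n generalizing φ ψ with
  | zero => rfl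
  | succ n ih => simp only [binE_succ, ih]; ring

theorem binE_sum {ι : Type*} (s : Finset ι) (n : ℕ) (p : ℝ) (φ : ι → ℕ → ℝ) :
    binE n p (fun j => ∑ r ∈ s, φ r j) = ∑ r ∈ s, binE n p (φ r) := by
  classical
  induction s using Finset.induction_on with
  | empty => simpa using binE_const n p 0
  | insert a s ha ih => simp only [sum_insert ha, binE_add, ih]

theorem binE_mono {n : ℕ} {p : ℝ} (h0 : 0 ≤ p) (h1 : p ≤ 1) {φ ψ : ℕ → ℝ}
    (h : ∀ j, φ j ≤ ψ j) : binE n p φ ≤ binE n p ψ := by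
  induction n generalizing φ ψ with
  | zero => exact h 0
  | succ n ih =>
    simp only [binE_succ]
    exact add_le_add (mul_le_mul_of_nonneg_left (ih fun j => h (j + 1)) h0)
      (mul_le_mul_of_nonneg_left (ih h) (by linarith))

theorem binE_nonneg {n : ℕ} {p : ℝ} (h0 : 0 ≤ p) (h1 : p ≤ 1) {φ : ℕ → ℝ}
    (h : ∀ j, 0 ≤ φ j) : 0 ≤ binE n p φ :=
  (binE_const n p 0).symm.trans_le (binE_mono h0 h1 h)

theorem abs_binE_le {n : ℕ} {p : ℝ} (h0 : 0 ≤ p) (h1 : p ≤ 1) (φ : ℕ → ℝ) :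
    |binE n p φ| ≤ binE n p (fun j => |φ j|) := by
  rw [abs_le]
  constructor
  · have := binE_mono (n := n) h0 h1 (fun j => neg_abs_le (φ j))
    have e := binE_const_mul n p (-1) (fun j => |φ j|)
    simp only [neg_mul, one_mul] at e
    rwa [e] at this
  · exact binE_mono h0 h1 fun j => le_abs_self _

theorem abs_binE_le_of_abs_le {n : ℕ} {p : ℝ} (h0 : 0 ≤ p) (h1 : p ≤ 1) {φ : ℕ → ℝ} {c : ℝ}
    (h : ∀ j, |φ j| ≤ c) : |binE n p φ| ≤ c :=
  (abs_binE_le h0 h1 φ).trans ((binE_mono h0 h1 h).trans_eq (binE_const n p c))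

/-- Tilted factorial moments. The case `z = 1` gives unbiased estimation of powers of `p`; `z = 2`
serves exponential tail bounds for the same statistics. -/
theorem binE_choose_mul_pow (n r : ℕ) (p z : ℝ) :
    binE n p (fun j => (j.choose r : ℝ) * z ^ j) =
      n.choose r * (z * p) ^ r * (1 - p + z * p) ^ (n - r) := by
  induction n generalizing r with
  | zero => cases r <;> simp [binE_zero]
  | succ n ih =>
    have h1 : ∀ r, binE n p (fun j => (j.choose r : ℝ) * z ^ (j + 1)) =
        z * (n.choose r * (z * p) ^ r * (1 - p + z * p) ^ (n - r)) := by
      intro r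
      rw [← ih, ← binE_const_mul]
      congr 1; ext j; ring
    rw [binE_succ]
    cases r with
    | zero =>
      have := ih 0
      have h2 := h1 0
      simp only [Nat.choose_zero_right, Nat.cast_one, one_mul, pow_zero, Nat.sub_zero] at *
      rw [this, h2]; ring
    | succ r =>
      have h2 : binE n p (fun j => ((j + 1).choose (r + 1) : ℝ) * z ^ (j + 1)) =
          z * (n.choose r * (z * p) ^ r * (1 - p + z * p) ^ (n - r)) +
          z * (n.choose (r + 1) * (z * p) ^ (r + 1) * (1 - p + z * p) ^ (n - (r + 1))) := by
        rw [← h1, ← h1, ← binE_add]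
        congr 1; ext j
        rw [Nat.choose_succ_succ]; push_cast; ring
      rw [h2, ih]
      rcases lt_or_ge n (r + 1) with h | h
      · rw [Nat.choose_eq_zero_of_lt h, Nat.choose_succ_succ, Nat.choose_eq_zero_of_lt h,
          Nat.add_sub_add_right]
        push_cast; ring
      · obtain ⟨e, rfl⟩ := Nat.exists_eq_add_of_le h
        rw [Nat.choose_succ_succ (r + 1 + e) r,
          show r + 1 + e + 1 - (r + 1) = e + 1 by omega, show r + 1 + e - (r + 1) = e by omega,
          show r + 1 + e - r = e + 1 by omega]
        push_cast; ring

theorem binE_pow (n : ℕ) (p z : ℝ) : binE n p (fun j => z ^ j) = (1 - p + z * p) ^ n := by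
  simpa using binE_choose_mul_pow n 0 p z

theorem binE_choose (n r : ℕ) (p : ℝ) :
    binE n p (fun j => (j.choose r : ℝ)) = n.choose r * p ^ r := by
  simpa using binE_choose_mul_pow n r p 1

theorem binE_id (n : ℕ) (p : ℝ) : binE n p (fun j => (j : ℝ)) = n * p := by
  simpa using binE_choose n 1 p

theorem binE_sq_sub (n : ℕ) (p : ℝ) :
    binE n p (fun j => ((j : ℝ) - n * p) ^ 2) = n * (p * (1 - p)) := by
  have e : (fun j : ℕ => ((j : ℝ) - n * p) ^ 2) =
      fun j : ℕ => (2 * (j.choose 2 : ℝ) + (1 - 2 * (n * p)) * j) + (n * p) ^ 2 := by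
    ext j; rw [Nat.cast_choose_two]; ring
  rw [e, binE_add, binE_add, binE_const_mul, binE_const_mul, binE_const, binE_id, binE_choose,
    Nat.cast_choose_two]
  ring

theorem binE_sq_le {n : ℕ} {p : ℝ} (h0 : 0 ≤ p) (h1 : p ≤ 1) (φ : ℕ → ℝ) :
    binE n p φ ^ 2 ≤ binE n p (fun j => φ j ^ 2) := by
  set c := binE n p φ with hc
  have h : 0 ≤ binE n p (fun j => (φ j - c) ^ 2) := binE_nonneg h0 h1 fun j => sq_nonneg _
  have e : (fun j : ℕ => (φ j - c) ^ 2) = fun j : ℕ => (φ j ^ 2 + (-2 * c) * φ j) + c ^ 2 := by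
    ext j; ring
  rw [e, binE_add, binE_add, binE_const_mul, binE_const, ← hc] at h
  nlinarith

theorem binE_abs_sub_le_sqrt {n : ℕ} {p : ℝ} (hn : 0 < n) (h0 : 0 ≤ p) (h1 : p ≤ 1) :
    binE n p (fun j => |(j : ℝ) / n - p|) ≤ √(p / n) := by
  have hn' : (0 : ℝ) < n := by exact_mod_cast hn
  apply Real.le_sqrt_of_sq_le
  refine (binE_sq_le h0 h1 _).trans ?_
  have e : (fun j : ℕ => |(j : ℝ) / n - p| ^ 2) =
      fun j : ℕ => (1 / (n : ℝ) ^ 2) * ((j : ℝ) - n * p) ^ 2 := by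
    ext j; rw [sq_abs]; field_simp
  rw [e, binE_const_mul, binE_sq_sub, show 1 / (n : ℝ) ^ 2 * (n * (p * (1 - p))) =
    p * (1 - p) / n by field_simp]
  gcongr
  nlinarith

theorem binE_abs_sub_le_two_mul {n : ℕ} {p : ℝ} (hn : 0 < n) (h0 : 0 ≤ p) (h1 : p ≤ 1) :
    binE n p (fun j => |(j : ℝ) / n - p|) ≤ 2 * p := by
  have hn' : (0 : ℝ) < n := by exact_mod_cast hn
  have : binE n p (fun j => |(j : ℝ) / n - p|) ≤ binE n p (fun j => (1 / (n : ℝ)) * j + p) := by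
    refine binE_mono h0 h1 fun j => ?_
    have : (0 : ℝ) ≤ (j : ℝ) / n := by positivity
    rw [abs_le]; constructor <;> · rw [one_div_mul_eq_div]; linarith
  refine this.trans_eq ?_
  rw [binE_add, binE_const_mul, binE_const, binE_id]
  field_simp; ring

/-! ### Bernstein polynomials: bias and differentiation -/

/-- The mean of the plug-in estimator of `|p - q|` from `n` samples: the Bernstein polynomial of
`x ↦ |x - q|`. -/
noncomputable def bern (n : ℕ) (q p : ℝ) : ℝ := binE n p (fun j => |(j : ℝ) / n - q|)

theorem abs_bern_sub_le (n : ℕ) {p : ℝ} (q : ℝ) (h0 : 0 ≤ p) (h1 : p ≤ 1) :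
    |bern n q p - (|p - q|)| ≤ binE n p (fun j => |(j : ℝ) / n - p|) := by
  have e : bern n q p - |p - q| = binE n p (fun j => |(j : ℝ) / n - q| - |p - q|) := by
    rw [binE_sub, binE_const, bern]
  rw [e]
  refine (abs_binE_le h0 h1 _).trans (binE_mono h0 h1 fun j => ?_)
  refine (abs_abs_sub_abs_le _ _).trans (le_of_eq ?_)
  congr 1; ring

/-- Differentiating in the success probability turns the function into its forward difference, with
one trial fewer; the induction is the product rule applied to the defining recursion. -/
theorem hasDerivAt_binE (n : ℕ) (φ : ℕ → ℝ) (x : ℝ) :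
    HasDerivAt (fun x => binE (n + 1) x φ)
      ((n + 1) * binE n x (fun j => φ (j + 1) - φ j)) x := by
  induction n generalizing φ with
  | zero =>
    have := ((hasDerivAt_id x).mul_const (φ (0 + 1))).add
      (((hasDerivAt_id x).const_sub 1).mul_const (φ 0))
    refine HasDerivAt.congr_deriv this ?_
    simp [binE_zero]; ring
  | succ n ih =>
    have h := ((hasDerivAt_id x).mul (ih (fun j => φ (j + 1)))).add
      (((hasDerivAt_id x).const_sub 1).mul (ih φ))
    refine HasDerivAt.congr_deriv h ?_
    rw [binE_sub (n + 1), binE_sub n, binE_sub n, binE_succ n x φ,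
      binE_succ n x (fun j => φ (j + 1))]
    simp only [id]
    push_cast; ring

theorem binE_eq_sum (n : ℕ) (p : ℝ) (φ : ℕ → ℝ) :
    binE n p φ = ∑ j ∈ range (n + 1), (n.choose j * p ^ j * (1 - p) ^ (n - j)) * φ j := by
  induction n generalizing φ with
  | zero => simp [binE_zero]
  | succ n ih =>
    rw [binE_succ, ih, ih, sum_range_succ' _ (n + 1)]
    have h1 : ∑ k ∈ range (n + 1), ((n + 1).choose (k + 1) : ℝ) * p ^ (k + 1) *
        (1 - p) ^ (n + 1 - (k + 1)) * φ (k + 1) =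
        p * ∑ j ∈ range (n + 1), (n.choose j * p ^ j * (1 - p) ^ (n - j)) * φ (j + 1) +
        ∑ j ∈ range (n + 1), (n.choose (j + 1) * p ^ (j + 1) * (1 - p) ^ (n - j)) * φ (j + 1) := by
      rw [mul_sum, ← sum_add_distrib]
      refine sum_congr rfl fun k _ => ?_
      rw [Nat.choose_succ_succ, Nat.add_sub_add_right]; push_cast; ring
    have h2 : (1 - p) * ∑ j ∈ range (n + 1), (n.choose j * p ^ j * (1 - p) ^ (n - j)) * φ j =
        ∑ j ∈ range (n + 1), (n.choose (j + 1) * p ^ (j + 1) * (1 - p) ^ (n - j)) * φ (j + 1) +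
        (1 - p) ^ (n + 1) * φ 0 := by
      rw [sum_range_succ' _ n, sum_range_succ _ n, Nat.choose_succ_self, mul_add, mul_sum]
      simp only [Nat.cast_zero, zero_mul, add_zero, Nat.choose_zero_right, Nat.cast_one, pow_zero,
        Nat.sub_zero, one_mul]
      congr 1
      · refine sum_congr rfl fun k hk => ?_
        have : n - k = n - (k + 1) + 1 := by have := mem_range.1 hk; omega
        rw [this]; ring
      · ring
    rw [h1, h2]
    simp; ring

/-! ### Hellinger distance between binomial laws -/

/-- The Bernoulli affinity is `1` minus half the sum of `(√x - √y) ^ 2` and the same square at `1 -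
x`, `1 - y`. Below `1 / 2` the latter square is the smaller one: the differences of squares agree up
to sign, and the roots at `1 - x`, `1 - y` have the larger sum. -/
theorem sqrt_mul_add_sqrt_mul_ge {x y : ℝ} (hx : 0 ≤ x) (hx' : x ≤ 1 / 2) (hy : 0 ≤ y)
    (hy' : y ≤ 1 / 2) : 1 - (√x - √y) ^ 2 ≤ √(x * y) + √((1 - x) * (1 - y)) := by
  rw [Real.sqrt_mul hx, Real.sqrt_mul (by linarith)]
  have hX := Real.sq_sqrt hx
  have hY := Real.sq_sqrt hy
  have hX' := Real.sq_sqrt (show 0 ≤ 1 - x by linarith)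
  have hY' := Real.sq_sqrt (show 0 ≤ 1 - y by linarith)
  have h1 : √x ≤ √(1 - x) := Real.sqrt_le_sqrt (by linarith)
  have h2 : √y ≤ √(1 - y) := Real.sqrt_le_sqrt (by linarith)
  have := Real.sqrt_nonneg x
  have := Real.sqrt_nonneg y
  set X := √x
  set Y := √y
  set X' := √(1 - x)
  set Y' := √(1 - y)
  have key : (X' - Y') ^ 2 ≤ (X - Y) ^ 2 := by
    have e : (X' - Y') * (X' + Y') = -((X - Y) * (X + Y)) := by nlinarith
    rcases (add_nonneg (h1.trans' ‹0 ≤ X›) (h2.trans' ‹0 ≤ Y›)).eq_or_lt with h | h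
    · have : X' = 0 := by nlinarith
      have : Y' = 0 := by nlinarith
      have : X' - Y' = 0 := by linarith
      rw [this]; nlinarith [sq_nonneg (X - Y)]
    · have e2 : (X' - Y') ^ 2 * (X' + Y') ^ 2 = (X - Y) ^ 2 * (X + Y) ^ 2 := by
        rw [← mul_pow, ← mul_pow, e]; ring
      have h3 : (X + Y) ^ 2 ≤ (X' + Y') ^ 2 := by
        apply pow_le_pow_left₀ <;> linarith
      have h4 : (X' - Y') ^ 2 * (X' + Y') ^ 2 ≤ (X - Y) ^ 2 * (X' + Y') ^ 2 := by
        rw [e2]; exact mul_le_mul_of_nonneg_left h3 (sq_nonneg _)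
      exact le_of_mul_le_mul_right h4 (by positivity)
  nlinarith

/-- Affinity is multiplicative over independent trials; for binomial weights this is the binomial
theorem. -/
theorem sum_sqrt_binomial_mul (n : ℕ) {x y : ℝ} (hx : 0 ≤ x) (hx' : x ≤ 1) (hy : 0 ≤ y)
    (hy' : y ≤ 1) :
    ∑ j ∈ range (n + 1), √(n.choose j * x ^ j * (1 - x) ^ (n - j)) *
      √(n.choose j * y ^ j * (1 - y) ^ (n - j)) =
      (√(x * y) + √((1 - x) * (1 - y))) ^ n := by
  rw [add_pow]
  refine sum_congr rfl fun j _ => ?_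
  have h1 : 0 ≤ 1 - x := by linarith
  have h2 : 0 ≤ 1 - y := by linarith
  rw [← Real.sqrt_mul (by positivity), show (n.choose j : ℝ) * x ^ j * (1 - x) ^ (n - j) *
    (n.choose j * y ^ j * (1 - y) ^ (n - j)) =
    (√(x * y) ^ j * √((1 - x) * (1 - y)) ^ (n - j) * n.choose j) ^ 2 from ?_]
  · exact Real.sqrt_sq (by positivity)
  · rw [mul_pow, mul_pow, ← pow_mul, ← pow_mul, mul_comm j, mul_comm (n - j), pow_mul, pow_mul,
      Real.sq_sqrt (by positivity), Real.sq_sqrt (by positivity), mul_pow, mul_pow]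
    ring

/-- Expectations of a bounded function under two binomial laws differ by at most the Hellinger
distance of the laws. -/
theorem abs_binE_sub_le (n : ℕ) {x y : ℝ} (hx : 0 ≤ x) (hx' : x ≤ 1 / 2) (hy : 0 ≤ y)
    (hy' : y ≤ 1 / 2) {φ : ℕ → ℝ} (hφ : ∀ j, |φ j| ≤ 1) :
    |binE n x φ - binE n y φ| ≤ 2 * √(2 * n) * |√x - √y| := by
  set w : ℝ → ℕ → ℝ := fun x j => n.choose j * x ^ j * (1 - x) ^ (n - j) with hw
  have h1x : 0 ≤ 1 - x := by linarith
  have h1y : 0 ≤ 1 - y := by linarith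
  have wx : ∀ j, 0 ≤ w x j := fun j => by simp only [hw]; positivity
  have wy : ∀ j, 0 ≤ w y j := fun j => by simp only [hw]; positivity
  have sw : ∀ z, ∑ j ∈ range (n + 1), w z j = 1 := by
    intro z
    have := binE_eq_sum n z (fun _ => 1)
    simpa [binE_const] using this.symm
  have hs := sum_sqrt_binomial_mul n hx (by linarith) hy (by linarith)
  -- Bernoulli's inequality applied to the `n`-th power of the affinity.
  have hb : 1 - n * (√x - √y) ^ 2 ≤ (√(x * y) + √((1 - x) * (1 - y))) ^ n := by
    have := one_add_mul_le_pow (a := √(x * y) + √((1 - x) * (1 - y)) - 1)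
      (by linarith [Real.sqrt_nonneg (x * y), Real.sqrt_nonneg ((1 - x) * (1 - y))]) n
    rw [add_sub_cancel] at this
    refine le_trans ?_ this
    have := sqrt_mul_add_sqrt_mul_ge hx hx' hy hy'
    have hn : (0 : ℝ) ≤ n := Nat.cast_nonneg n
    nlinarith [mul_le_mul_of_nonneg_left this hn]
  have hs' : ∑ j ∈ range (n + 1), √(w x j) * √(w y j) =
    (√(x * y) + √((1 - x) * (1 - y))) ^ n := hs
  have hminus : ∑ j ∈ range (n + 1), (√(w x j) - √(w y j)) ^ 2 ≤ 2 * n * (√x - √y) ^ 2 := by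
    have : ∑ j ∈ range (n + 1), (√(w x j) - √(w y j)) ^ 2 =
        ∑ j ∈ range (n + 1), (w x j + w y j - 2 * (√(w x j) * √(w y j))) := by
      refine sum_congr rfl fun j _ => ?_
      nlinarith [Real.sq_sqrt (wx j), Real.sq_sqrt (wy j)]
    rw [this, sum_sub_distrib, sum_add_distrib, sw, sw, ← mul_sum, hs']
    linarith
  have hplus : ∑ j ∈ range (n + 1), (√(w x j) + √(w y j)) ^ 2 ≤ 4 := by
    have : ∀ j ∈ range (n + 1), (√(w x j) + √(w y j)) ^ 2 ≤ 2 * w x j + 2 * w y j := by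
      intro j _
      nlinarith [Real.sq_sqrt (wx j), Real.sq_sqrt (wy j), sq_nonneg (√(w x j) - √(w y j))]
    refine (sum_le_sum this).trans ?_
    rw [sum_add_distrib, ← mul_sum, ← mul_sum, sw, sw]; norm_num
  -- Each difference of weights factors as a difference times a sum of square roots; Cauchy–Schwarz
  -- then combines `hminus` and `hplus`.
  have hd : |binE n x φ - binE n y φ| ≤ ∑ j ∈ range (n + 1), |√(w x j) - √(w y j)| *
      (√(w x j) + √(w y j)) := by
    rw [binE_eq_sum, binE_eq_sum, ← sum_sub_distrib]
    refine (abs_sum_le_sum_abs _ _).trans (sum_le_sum fun j _ => ?_)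
    have e : w x j * φ j - w y j * φ j = (√(w x j) - √(w y j)) * (√(w x j) + √(w y j)) * φ j := by
      linear_combination (-φ j) * (Real.sq_sqrt (wx j)) + φ j * Real.sq_sqrt (wy j)
    change |w x j * φ j - w y j * φ j| ≤ _
    rw [e, abs_mul, abs_mul, abs_of_nonneg (add_nonneg (Real.sqrt_nonneg (w x j)) (Real.sqrt_nonneg _))]
    exact mul_le_of_le_one_right (by positivity) (hφ j)
  have cs := sum_mul_sq_le_sq_mul_sq (range (n + 1)) (fun j => |√(w x j) - √(w y j)|)
    (fun j => √(w x j) + √(w y j))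
  simp only [sq_abs] at cs
  refine hd.trans (abs_le_of_sq_le_sq' ?_ (by positivity)).2
  refine cs.trans ?_
  rw [mul_pow, mul_pow, sq_abs, Real.sq_sqrt (by positivity)]
  calc _ ≤ (2 * n * (√x - √y) ^ 2) * 4 := mul_le_mul hminus hplus (by positivity) (by positivity)
    _ = _ := by ring

/-! ### A discrete Jackson kernel -/

/-- The nonnegative trigonometric polynomial `|∑ j < n, c j * exp (i j u)| ^ 2`. -/
noncomputable def sqKernel (n : ℕ) (c : ℕ → ℝ) (u : ℝ) : ℝ :=
  ∑ i ∈ range n, ∑ j ∈ range n, c i * c j * Real.cos (((i : ℤ) - (j : ℤ) : ℤ) * u)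

theorem sqKernel_eq_normSq (n : ℕ) (c : ℕ → ℝ) (u : ℝ) :
    sqKernel n c u =
      Complex.normSq (∑ j ∈ range n, (c j : ℂ) * Complex.exp (u * Complex.I) ^ j) := by
  have hre : ∀ j : ℕ, ((c j : ℂ) * Complex.exp (u * Complex.I) ^ j).re = c j * Real.cos (j * u) := by
    intro j
    rw [← Complex.exp_nat_mul, show (j : ℂ) * (u * Complex.I) = ((j * u : ℝ) : ℂ) * Complex.I by
      push_cast; ring, Complex.re_ofReal_mul, Complex.exp_ofReal_mul_I_re]
  have him : ∀ j : ℕ, ((c j : ℂ) * Complex.exp (u * Complex.I) ^ j).im = c j * Real.sin (j * u) := by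
    intro j
    rw [← Complex.exp_nat_mul, show (j : ℂ) * (u * Complex.I) = ((j * u : ℝ) : ℂ) * Complex.I by
      push_cast; ring, Complex.im_ofReal_mul, Complex.exp_ofReal_mul_I_im]
  rw [Complex.normSq_apply, Complex.re_sum, Complex.im_sum, sum_mul_sum, sum_mul_sum,
    ← sum_add_distrib, sqKernel]
  refine sum_congr rfl fun i _ => ?_
  rw [← sum_add_distrib]
  refine sum_congr rfl fun j _ => ?_
  rw [hre, hre, him, him]
  push_cast
  rw [sub_mul, Real.cos_sub]; ring

theorem sqKernel_nonneg (n : ℕ) (c : ℕ → ℝ) (u : ℝ) : 0 ≤ sqKernel n c u := by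
  rw [sqKernel_eq_normSq]; exact Complex.normSq_nonneg _

/-- Summation by parts: multiplying the exponential sum by `1 - z` differences the coefficients, and
`|1 - z| ^ 2 = 4 * sin (u / 2) ^ 2` on the unit circle. The vanishing end coefficients remove the
boundary terms. -/
theorem four_mul_sin_sq_mul_sqKernel (n : ℕ) (c : ℕ → ℝ) (h0 : c 0 = 0) (hn : c n = 0) (u : ℝ) :
    4 * Real.sin (u / 2) ^ 2 * sqKernel n c u = sqKernel n (fun j => c (j + 1) - c j) u := by
  rw [sqKernel_eq_normSq, sqKernel_eq_normSq]
  set z := Complex.exp (u * Complex.I) with hz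
  have hz1 : Complex.normSq z = 1 := by
    rw [Complex.normSq_eq_norm_sq, hz, Complex.norm_exp_ofReal_mul_I]; norm_num
  have h1z : Complex.normSq (1 - z) = 4 * Real.sin (u / 2) ^ 2 := by
    rw [Complex.normSq_apply, Complex.sub_re, Complex.sub_im, hz, Complex.exp_ofReal_mul_I_re,
      Complex.exp_ofReal_mul_I_im, Complex.one_re, Complex.one_im]
    have := Real.sin_sq_eq_half_sub (u / 2)
    rw [show 2 * (u / 2) = u by ring] at this
    rw [this]; nlinarith [Real.sin_sq_add_cos_sq u]
  have key : z * ∑ j ∈ range n, ((c (j + 1) - c j : ℝ) : ℂ) * z ^ j =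
      (1 - z) * ∑ j ∈ range n, (c j : ℂ) * z ^ j := by
    have e1 : ∑ j ∈ range n, (c (j + 1) : ℂ) * z ^ (j + 1) = ∑ j ∈ range n, (c j : ℂ) * z ^ j := by
      have := sum_range_succ' (fun j => (c j : ℂ) * z ^ j) n
      rw [sum_range_succ, hn, h0] at this
      simpa using this.symm
    rw [sub_mul, one_mul, mul_sum, mul_sum]
    nth_rewrite 1 [← e1]
    rw [← sum_sub_distrib]
    refine sum_congr rfl fun j _ => ?_
    push_cast; ring
  have := congrArg Complex.normSq key
  rw [Complex.normSq_mul, Complex.normSq_mul, hz1, h1z, one_mul] at this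
  exact this.symm

theorem sum_cos_equispaced {M : ℕ} {r : ℤ} (hr : r ≠ 0) (hr' : |r| < M) (θ : ℝ) :
    ∑ l ∈ range M, Real.cos (r * (θ + 2 * Real.pi * l / M)) = 0 := by
  have hM : (M : ℂ) ≠ 0 := by
    have : 0 < (M : ℤ) := (abs_nonneg r).trans_lt hr'
    exact_mod_cast this.ne'
  set w := Complex.exp (2 * Real.pi * Complex.I * (r / M)) with hw
  have hwM : w ^ M = 1 := by
    rw [hw, ← Complex.exp_nat_mul, Complex.exp_eq_one_iff]
    exact ⟨r, by field_simp⟩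
  have hw1 : w ≠ 1 := by
    rw [hw, Ne, Complex.exp_eq_one_iff]
    rintro ⟨k, hk⟩
    have hpi := Complex.two_pi_I_ne_zero
    have h2 : (r : ℂ) = k * M := by
      have : (r : ℂ) / M = k := by
        apply mul_left_cancel₀ hpi; linear_combination hk
      rw [← this]; field_simp
    have h3 : r = k * M := by exact_mod_cast h2
    rcases eq_or_ne k 0 with rfl | hk0
    · simp at h3; exact hr h3
    · have : (1 : ℤ) ≤ |k| := Int.one_le_abs hk0
      rw [h3, abs_mul, Nat.abs_cast] at hr'
      nlinarith [(Nat.cast_nonneg M : (0 : ℤ) ≤ M)]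
  have hsum : ∑ l ∈ range M, w ^ l = 0 := by
    have := mul_neg_geom_sum w M
    rw [hwM, sub_self] at this
    exact (mul_eq_zero.1 this).resolve_left (sub_ne_zero.2 hw1.symm)
  have : ∀ l : ℕ, Real.cos (r * (θ + 2 * Real.pi * l / M)) =
      (Complex.exp (r * θ * Complex.I) * w ^ l).re := by
    intro l
    rw [hw, ← Complex.exp_nat_mul, ← Complex.exp_add, ← Complex.exp_ofReal_mul_I_re]
    congr 2
    push_cast; ring
  simp only [this]
  rw [← Complex.re_sum, ← mul_sum, hsum, mul_zero, Complex.zero_re]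

/-- Parseval on an equispaced grid: every nonzero frequency `i - j` is less than `n` in absolute
value, so no aliasing occurs and only the diagonal survives. -/
theorem sum_sqKernel_equispaced (n : ℕ) (c : ℕ → ℝ) (θ : ℝ) :
    ∑ l ∈ range n, sqKernel n c (θ + 2 * Real.pi * l / n) = n * ∑ j ∈ range n, c j ^ 2 := by
  simp only [sqKernel]
  rw [sum_comm, mul_sum]
  refine sum_congr rfl fun i hi => ?_
  rw [sum_comm, sum_eq_single i]
  · simp only [sub_self, Int.cast_zero, zero_mul, Real.cos_zero, mul_one, sum_const, card_range,
      nsmul_eq_mul, sq]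
  · intro j hj hij
    rw [← mul_sum, sum_cos_equispaced, mul_zero]
    · rw [sub_ne_zero]; exact_mod_cast hij.symm
    · have := mem_range.1 hi; have := mem_range.1 hj
      rw [abs_lt]; constructor <;> omega
  · intro h; exact absurd hi h

/-- The triangular sequence rising from `0` to `N` and back to `0` at `2 * N`. -/
noncomputable def triangle (N j : ℕ) : ℝ := min (j : ℝ) (2 * N - j)

theorem triangle_zero (N : ℕ) : triangle N 0 = 0 := by
  simp [triangle]

theorem triangle_two_mul (N : ℕ) : triangle N (2 * N) = 0 := by
  simp [triangle]

theorem triangle_sub_sq_le (N j : ℕ) : (triangle N (j + 1) - triangle N j) ^ 2 ≤ 1 := by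
  rw [sq_le_one_iff_abs_le_one]
  unfold triangle
  push_cast
  rw [abs_le]
  constructor <;> rcases min_cases ((j : ℝ) + 1) (2 * N - (j + 1)) with h | h <;>
    rcases min_cases (j : ℝ) (2 * N - j) with h' | h' <;> linarith

theorem sum_triangle_sq_ge {N : ℕ} (hN : 1 ≤ N) :
    (N : ℝ) ^ 3 / 3 ≤ ∑ j ∈ range (2 * N), triangle N j ^ 2 := by
  have h1 : ∑ j ∈ range (N + 1), (j : ℝ) ^ 2 ≤ ∑ j ∈ range (2 * N), triangle N j ^ 2 := by
    refine le_trans (le_of_eq ?_) (sum_le_sum_of_subset_of_nonneg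
      (range_subset_range.2 (show N + 1 ≤ 2 * N by omega)) fun _ _ _ => sq_nonneg _)
    refine sum_congr rfl fun j hj => ?_
    have : (j : ℝ) ≤ N := by exact_mod_cast Nat.lt_succ_iff.1 (mem_range.1 hj)
    rw [triangle, min_eq_left (by linarith)]
  have h2 : ∀ N : ℕ, (N : ℝ) ^ 3 / 3 ≤ ∑ j ∈ range (N + 1), (j : ℝ) ^ 2 := by
    intro N
    induction N with
    | zero => simp
    | succ N ih => rw [sum_range_succ]; push_cast; nlinarith [(Nat.cast_nonneg N : (0 : ℝ) ≤ N)]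
  exact (h2 N).trans h1

/-- Cauchy–Schwarz between the total mass and the second moment of the kernel. Differencing the
triangle gives second moment at most `N ^ 2`, while its energy is at least `N ^ 3 / 3`, so the
normalised first moment is `O(1 / N)`. -/
theorem sum_abs_sin_mul_sqKernel_le {N : ℕ} (hN : 1 ≤ N) (θ : ℝ) :
    ∑ l ∈ range (2 * N), |Real.sin ((θ + 2 * Real.pi * l / (2 * N : ℕ)) / 2)| *
      sqKernel (2 * N) (triangle N) (θ + 2 * Real.pi * l / (2 * N : ℕ)) ≤
      (2 * N : ℕ) * (∑ j ∈ range (2 * N), triangle N j ^ 2) * (2 / N) := by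
  set A := ∑ j ∈ range (2 * N), triangle N j ^ 2 with hA
  set u : ℕ → ℝ := fun l => θ + 2 * Real.pi * l / (2 * N : ℕ) with hu
  set K := sqKernel (2 * N) (triangle N) with hK
  have hN0 : (0 : ℝ) < N := by exact_mod_cast hN
  have hAge := sum_triangle_sq_ge hN
  rw [← hA] at hAge
  have hK0 : ∀ x, 0 ≤ K x := sqKernel_nonneg _ _
  have s1 : ∑ l ∈ range (2 * N), K (u l) = (2 * N : ℕ) * A := sum_sqKernel_equispaced _ _ θ
  have s2 : ∑ l ∈ range (2 * N), Real.sin (u l / 2) ^ 2 * K (u l) ≤ (N : ℝ) ^ 2 := by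
    have e : ∀ l, Real.sin (u l / 2) ^ 2 * K (u l) =
        (1 / 4) * sqKernel (2 * N) (fun j => triangle N (j + 1) - triangle N j) (u l) := by
      intro l
      rw [← four_mul_sin_sq_mul_sqKernel _ _ (triangle_zero N) (triangle_two_mul N)]; ring
    simp only [e]
    rw [← mul_sum]
    simp only [hu]
    rw [sum_sqKernel_equispaced]
    have : ∑ j ∈ range (2 * N), (triangle N (j + 1) - triangle N j) ^ 2 ≤ (2 * N : ℕ) := by
      refine (sum_le_sum fun j _ => triangle_sub_sq_le N j).trans ?_
      simp
    push_cast at this ⊢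
    nlinarith
  have cs := sum_mul_sq_le_sq_mul_sq (range (2 * N))
    (fun l => |Real.sin (u l / 2)| * √(K (u l))) (fun l => √(K (u l)))
  have e1 : ∀ l, |Real.sin (u l / 2)| * √(K (u l)) * √(K (u l)) = |Real.sin (u l / 2)| * K (u l) := by
    intro l; rw [mul_assoc, Real.mul_self_sqrt (hK0 _)]
  have e2 : ∀ l, (|Real.sin (u l / 2)| * √(K (u l))) ^ 2 = Real.sin (u l / 2) ^ 2 * K (u l) := by
    intro l; rw [mul_pow, Real.sq_sqrt (hK0 _), sq_abs]
  simp only [e1, e2, Real.sq_sqrt (hK0 _), s1] at cs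
  have hA0 : 0 ≤ A := le_trans (by positivity) hAge
  refine (abs_le_of_sq_le_sq' (cs.trans ?_) (by positivity)).2
  calc _ ≤ (N : ℝ) ^ 2 * ((2 * N : ℕ) * A) := mul_le_mul_of_nonneg_right s2 (by positivity)
    _ ≤ 16 * A * A := by push_cast; nlinarith
    _ = ((2 * N : ℕ) * A * (2 / N)) ^ 2 := by push_cast; field_simp; ring

/-! ### Chebyshev coefficients and Jackson's theorem -/

open Polynomial in
theorem sum_abs_coeff_one_sub_two_X_mul (d : ℕ) (P : ℝ[X]) :
    ∑ r ∈ range d, |((1 - 2 * X) * P).coeff r| ≤ 3 * ∑ r ∈ range d, |P.coeff r| := by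
  have h : ∑ r ∈ range d, |(X * P).coeff r| ≤ ∑ r ∈ range d, |P.coeff r| := by
    cases d with
    | zero => simp
    | succ d =>
      rw [sum_range_succ', sum_range_succ]
      simp only [coeff_X_mul, coeff_X_mul_zero, abs_zero, add_zero]
      linarith [abs_nonneg (P.coeff d)]
  have h2 : ∀ r, |((1 - 2 * X) * P).coeff r| ≤ |P.coeff r| + 2 * |(X * P).coeff r| := by
    intro r
    rw [show (1 - 2 * X) * P = P - C 2 * (X * P) by rw [C_ofNat]; ring, coeff_sub, coeff_C_mul]
    refine (abs_sub _ _).trans ?_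
    rw [abs_mul, abs_two]
  refine (sum_le_sum fun r _ => h2 r).trans ?_
  rw [sum_add_distrib, ← mul_sum]
  linarith

-- Multiplication by `1 - 2 * X` at most triples the coefficient sum, so the recursion `T (n + 2) =
-- 2 * X * T (n + 1) - T n` costs `6 * 7 ^ (n + 1) + 7 ^ n ≤ 7 ^ (n + 2)`.
open Polynomial in
theorem sum_abs_coeff_chebyshev_comp_le (d n : ℕ) :
    ∑ r ∈ range d, |((Chebyshev.T ℝ n).comp (1 - 2 * X)).coeff r| ≤ 7 ^ n := by
  have h01 : ∑ r ∈ range d, |(1 : ℝ[X]).coeff r| ≤ 1 := by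
    simp only [coeff_one]
    cases d with
    | zero => simp
    | succ d => rw [sum_range_succ']; simp
  induction n using Nat.strong_induction_on with
  | _ n ih =>
    match n, ih with
    | 0, _ => simpa using h01
    | 1, _ =>
      have := sum_abs_coeff_one_sub_two_X_mul d 1
      simp only [mul_one] at this
      simp only [Nat.cast_one, Chebyshev.T_one, X_comp]
      linarith
    | n + 2, ih =>
      have i0 := ih n (by omega)
      have i1 := ih (n + 1) (by omega)
      set P := (Chebyshev.T ℝ n).comp (1 - 2 * X)
      set P' := (Chebyshev.T ℝ (n + 1 : ℕ)).comp (1 - 2 * X) with hP'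
      have e : (Chebyshev.T ℝ (n + 2 : ℕ)).comp (1 - 2 * X) = C 2 * ((1 - 2 * X) * P') - P := by
        have := Chebyshev.T_add_two ℝ (n : ℤ)
        push_cast at hP' ⊢
        rw [this, hP']
        simp only [sub_comp, mul_comp, X_comp, ofNat_comp, C_ofNat]
        ring
      have h2 : ∀ r, |(C 2 * ((1 - 2 * X) * P') - P).coeff r| ≤
          2 * |((1 - 2 * X) * P').coeff r| + |P.coeff r| := by
        intro r
        rw [coeff_sub, coeff_C_mul]
        refine (abs_sub _ _).trans ?_
        rw [abs_mul, abs_two]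
      rw [e]
      refine (sum_le_sum fun r _ => h2 r).trans ?_
      rw [sum_add_distrib, ← mul_sum]
      have := sum_abs_coeff_one_sub_two_X_mul d P'
      have h7 : (1 : ℝ) ≤ 7 ^ n := one_le_pow₀ (by norm_num)
      rw [pow_succ] at i1
      rw [pow_add]
      linarith

open Polynomial in
/-- Jackson's theorem for functions on `[0, 1]` that are Lipschitz in `√u`, with a bound on the
coefficients of the approximating polynomial. -/
theorem exists_jackson_polynomial {N : ℕ} (hN : 1 ≤ N) {G : ℝ → ℝ} {Λ : ℝ}
    (hG : ∀ u ∈ Set.Icc (0 : ℝ) 1, |G u| ≤ 1)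
    (hL : ∀ u ∈ Set.Icc (0 : ℝ) 1, ∀ v ∈ Set.Icc (0 : ℝ) 1, |G u - G v| ≤ Λ * |√u - √v|) :
    ∃ Q : ℝ[X], Q.natDegree < 2 * N ∧
      ∑ r ∈ range (2 * N), |Q.coeff r| ≤ 2 * N * 7 ^ (2 * N) ∧
      ∀ u ∈ Set.Icc (0 : ℝ) 1, |Q.eval u - G u| ≤ Λ * (2 / N) := by
  set M := 2 * N with hM
  set A := ∑ j ∈ range M, triangle N j ^ 2 with hA
  have hN0 : (0 : ℝ) < N := by exact_mod_cast hN
  have hM0 : (0 : ℝ) < M := by rw [hM]; push_cast; linarith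
  have hA0 : 0 < A := lt_of_lt_of_le (by positivity) (sum_triangle_sq_ge hN)
  have hΛ : 0 ≤ Λ := by
    have := hL 0 (by simp) 1 (by simp)
    simp only [Real.sqrt_zero, Real.sqrt_one, zero_sub, abs_neg, abs_one, mul_one] at this
    exact (abs_nonneg _).trans this
  set s : ℕ → ℝ := fun l => 2 * Real.pi * l / M with hs
  -- With `u = sin (θ / 2) ^ 2`, `√u` is `|sin (θ / 2)|`. Being Lipschitz in `√u` then bounds
  -- increments of `g` by exactly the weight whose kernel moment is controlled.
  set g : ℝ → ℝ := fun θ => G (Real.sin (θ / 2) ^ 2) with hg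
  have hmem : ∀ θ : ℝ, Real.sin (θ / 2) ^ 2 ∈ Set.Icc (0 : ℝ) 1 := fun θ =>
    ⟨sq_nonneg _, Real.sin_sq_le_one _⟩
  have hg1 : ∀ θ, |g θ| ≤ 1 := fun θ => hG _ (hmem θ)
  have hsin : ∀ a b : ℝ, |(|Real.sin a| - |Real.sin b|)| ≤ |Real.sin (a + b)| := by
    have h1 : ∀ a b : ℝ, |Real.sin a| ≤ |Real.sin (a + b)| + |Real.sin b| := by
      intro a b
      have : Real.sin a = Real.sin (a + b) * Real.cos b - Real.cos (a + b) * Real.sin b := by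
        rw [← Real.sin_sub]; ring_nf
      rw [this]
      refine (abs_sub _ _).trans ?_
      rw [abs_mul, abs_mul]
      exact add_le_add (mul_le_of_le_one_right (abs_nonneg _) (Real.abs_cos_le_one _))
        (mul_le_of_le_one_left (abs_nonneg _) (Real.abs_cos_le_one _))
    intro a b
    rw [abs_le]
    have := h1 a b
    have := h1 b a
    rw [add_comm b a] at this
    constructor <;> linarith
  have hgL : ∀ θ t, |g t - g θ| ≤ Λ * |Real.sin ((θ + t) / 2)| := by
    intro θ t
    refine (hL _ (hmem t) _ (hmem θ)).trans (mul_le_mul_of_nonneg_left ?_ hΛ)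
    rw [Real.sqrt_sq_eq_abs, Real.sqrt_sq_eq_abs]
    refine (hsin _ _).trans (le_of_eq ?_)
    congr 2; ring
  have hgL' : ∀ θ t, |g t - g θ| ≤ Λ * |Real.sin ((-θ + t) / 2)| := by
    intro θ t
    have : g (-θ) = g θ := by simp only [hg]; rw [neg_div, Real.sin_neg, neg_sq]
    rw [← this]; exact hgL _ _
  -- Discrete cosine coefficients of `g`. Convolving with the kernel multiplies them by triangle
  -- products, and `cos (r * θ)` becomes a Chebyshev polynomial in `cos θ = 1 - 2 * u`.
  set co : ℤ → ℝ := fun r => (∑ l ∈ range M, g (s l) * Real.cos (r * s l)) / M with hco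
  have hco1 : ∀ r, |co r| ≤ 1 := by
    intro r
    rw [hco, abs_div, abs_of_pos hM0, div_le_one hM0]
    refine (abs_sum_le_sum_abs _ _).trans ?_
    refine (sum_le_sum (g := fun _ => (1 : ℝ)) fun l _ => ?_).trans (by simp)
    rw [abs_mul]
    exact mul_le_one₀ (hg1 _) (abs_nonneg _) (Real.abs_cos_le_one _)
  set wt : ℕ → ℕ → ℝ := fun i j => triangle N i * triangle N j / A * co ((i : ℤ) - j) with hwt
  set Q : ℝ[X] := ∑ i ∈ range M, ∑ j ∈ range M,
    C (wt i j) * (Chebyshev.T ℝ ((i : ℤ) - j)).comp (1 - 2 * X) with hQ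
  refine ⟨Q, ?_, ?_, ?_⟩
  · rw [hQ]
    refine Nat.lt_of_le_pred (by omega) (natDegree_sum_le_of_forall_le _ _ fun i hi => ?_)
    refine natDegree_sum_le_of_forall_le _ _ fun j hj => ?_
    refine (natDegree_C_mul_le _ _).trans (natDegree_comp_le.trans ?_)
    rw [Chebyshev.natDegree_T]
    have hdeg : (1 - 2 * X : ℝ[X]).natDegree ≤ 1 := by compute_degree
    have := mem_range.1 hi; have := mem_range.1 hj
    calc _ ≤ ((i : ℤ) - j).natAbs * 1 := Nat.mul_le_mul_left _ hdeg
      _ ≤ _ := by rw [Nat.pred_eq_sub_one]; omega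
  · have hw : ∑ i ∈ range M, ∑ j ∈ range M, |wt i j| ≤ M := by
      have h1 : ∀ i j, |wt i j| ≤ (triangle N i ^ 2 + triangle N j ^ 2) / (2 * A) := by
        intro i j
        rw [hwt, abs_mul, abs_div, abs_of_pos hA0]
        refine (mul_le_of_le_one_right (by positivity) (hco1 _)).trans ?_
        rw [div_le_div_iff₀ hA0 (by positivity), abs_mul]
        have : 2 * (|triangle N i| * |triangle N j|) ≤ triangle N i ^ 2 + triangle N j ^ 2 := by
          rw [← sq_abs (triangle N i), ← sq_abs (triangle N j)]
          nlinarith [sq_nonneg (|triangle N i| - |triangle N j|)]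
        nlinarith
      refine (sum_le_sum fun i _ => sum_le_sum fun j _ => h1 i j).trans (le_of_eq ?_)
      simp only [← sum_div, sum_add_distrib, sum_const, card_range, nsmul_eq_mul, ← mul_sum]
      rw [← hA]; field_simp; ring
    have hcoeff : ∀ r, |Q.coeff r| ≤ ∑ i ∈ range M, ∑ j ∈ range M,
        |wt i j| * |((Chebyshev.T ℝ ((i : ℤ) - j)).comp (1 - 2 * X)).coeff r| := by
      intro r
      rw [hQ, finsetSum_coeff]
      refine (abs_sum_le_sum_abs _ _).trans (sum_le_sum fun i _ => ?_)
      rw [finsetSum_coeff]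
      refine (abs_sum_le_sum_abs _ _).trans (sum_le_sum fun j _ => ?_)
      rw [coeff_C_mul, abs_mul]
    calc ∑ r ∈ range M, |Q.coeff r| ≤ ∑ r ∈ range M, ∑ i ∈ range M, ∑ j ∈ range M,
        |wt i j| * |((Chebyshev.T ℝ ((i : ℤ) - j)).comp (1 - 2 * X)).coeff r| :=
          sum_le_sum fun r _ => hcoeff r
      _ = ∑ i ∈ range M, ∑ j ∈ range M, |wt i j| *
          ∑ r ∈ range M, |((Chebyshev.T ℝ ((i : ℤ) - j)).comp (1 - 2 * X)).coeff r| := by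
        rw [sum_comm]
        refine sum_congr rfl fun i _ => ?_
        rw [sum_comm]
        refine sum_congr rfl fun j _ => ?_
        rw [mul_sum]
      _ ≤ ∑ i ∈ range M, ∑ j ∈ range M, |wt i j| * 7 ^ M := by
        refine sum_le_sum fun i hi => sum_le_sum fun j hj => ?_
        refine mul_le_mul_of_nonneg_left ?_ (abs_nonneg _)
        rw [← Chebyshev.T_natAbs]
        refine (sum_abs_coeff_chebyshev_comp_le M _).trans ?_
        have := mem_range.1 hi; have := mem_range.1 hj
        exact pow_le_pow_right₀ (by norm_num) (by omega)
      _ ≤ 2 * N * 7 ^ M := by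
        simp only [← sum_mul]
        refine mul_le_mul_of_nonneg_right (hw.trans_eq ?_) (by positivity)
        rw [hM]; push_cast; ring
  · intro u hu
    obtain ⟨θ, hθ⟩ : ∃ θ : ℝ, Real.sin (θ / 2) ^ 2 = u := by
      refine ⟨2 * Real.arcsin √u, ?_⟩
      rw [mul_div_cancel_left₀ _ two_ne_zero, Real.sin_arcsin, Real.sq_sqrt hu.1]
      · linarith [Real.sqrt_nonneg u]
      · rw [Real.sqrt_le_one]; exact hu.2
    set K := sqKernel M (triangle N) with hK
    have hcos : 1 - 2 * u = Real.cos θ := by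
      rw [← hθ, Real.sin_sq_eq_half_sub, show 2 * (θ / 2) = θ by ring]; ring
    -- Symmetrising in `θ` cancels the sine terms, leaving a polynomial in `cos θ`.
    have hKsum : ∀ t, K (θ + t) + K (-θ + t) = 2 * ∑ i ∈ range M, ∑ j ∈ range M,
        triangle N i * triangle N j * (Real.cos (((i : ℤ) - (j : ℤ) : ℤ) * θ) *
          Real.cos (((i : ℤ) - (j : ℤ) : ℤ) * t)) := by
      intro t
      rw [hK, sqKernel, sqKernel, ← sum_add_distrib, mul_sum]
      refine sum_congr rfl fun i _ => ?_
      rw [← sum_add_distrib, mul_sum]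
      refine sum_congr rfl fun j _ => ?_
      rw [mul_add, mul_add, Real.cos_add, Real.cos_add, mul_neg, Real.cos_neg, Real.sin_neg]
      ring
    have hQe : Q.eval u = (∑ l ∈ range M, g (s l) * (K (θ + s l) + K (-θ + s l))) / (2 * M * A) := by
      have h1 : Q.eval u = ∑ i ∈ range M, ∑ j ∈ range M,
          wt i j * Real.cos (((i : ℤ) - (j : ℤ) : ℤ) * θ) := by
        rw [hQ, eval_finsetSum]
        refine sum_congr rfl fun i _ => ?_
        rw [eval_finsetSum]
        refine sum_congr rfl fun j _ => ?_
        rw [eval_mul, eval_C, eval_comp]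
        simp only [eval_sub, eval_one, eval_mul, eval_ofNat, eval_X]
        rw [hcos, Chebyshev.T_real_cos]
      rw [h1, eq_div_iff (by positivity)]
      simp only [hKsum, hwt, hco, mul_sum, sum_mul, sum_div]
      conv_rhs => rw [sum_comm]
      refine sum_congr rfl fun i _ => ?_
      conv_rhs => rw [sum_comm]
      refine sum_congr rfl fun j _ => ?_
      refine sum_congr rfl fun l _ => ?_
      field_simp
    have hone : g θ = (∑ l ∈ range M, g θ * (K (θ + s l) + K (-θ + s l))) / (2 * M * A) := by
      rw [← mul_sum, sum_add_distrib, sum_sqKernel_equispaced, sum_sqKernel_equispaced, ← hA]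
      field_simp; ring
    have hGu : G u = g θ := by simp only [hg]; rw [hθ]
    rw [hGu, hQe, hone, ← sub_div, ← sum_sub_distrib, abs_div, abs_of_pos (by positivity :
      0 < 2 * M * A), div_le_iff₀ (by positivity)]
    have b1 := sum_abs_sin_mul_sqKernel_le hN θ
    have b2 := sum_abs_sin_mul_sqKernel_le hN (-θ)
    rw [← hM, ← hA, ← hK] at b1 b2
    have hK0 : ∀ x, 0 ≤ K x := sqKernel_nonneg _ _
    calc _ ≤ ∑ l ∈ range M, Λ * (|Real.sin ((θ + s l) / 2)| * K (θ + s l) +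
          |Real.sin ((-θ + s l) / 2)| * K (-θ + s l)) := by
          refine (abs_sum_le_sum_abs _ _).trans (sum_le_sum fun l _ => ?_)
          rw [← sub_mul, abs_mul, abs_of_nonneg (add_nonneg (hK0 _) (hK0 _)), mul_add, mul_add,
            ← mul_assoc, ← mul_assoc]
          exact add_le_add (mul_le_mul_of_nonneg_right (hgL _ _) (hK0 _))
            (mul_le_mul_of_nonneg_right (hgL' _ _) (hK0 _))
      _ ≤ Λ * (M * A * (2 / N) + M * A * (2 / N)) := by
          rw [← mul_sum, sum_add_distrib]
          exact mul_le_mul_of_nonneg_left (add_le_add b1 b2) hΛ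
      _ = _ := by ring

/-! ### Expectations over samples and bounded differences -/

/-- The expectation of `F` on `n` independent samples from `p`. -/
noncomputable def expct {k n : ℕ} (p : Fin k → ℝ) (F : (Fin n → Fin k) → ℝ) : ℝ :=
  ∑ x : Fin n → Fin k, (∏ j, p (x j)) * F x

section expct

variable {k n : ℕ} {p : Fin k → ℝ}

theorem expct_add (F G : (Fin n → Fin k) → ℝ) :
    expct p (fun x => F x + G x) = expct p F + expct p G := by
  simp only [expct, mul_add, sum_add_distrib]

theorem expct_sub (F G : (Fin n → Fin k) → ℝ) :
    expct p (fun x => F x - G x) = expct p F - expct p G := by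
  simp only [expct, mul_sub, sum_sub_distrib]

theorem expct_const_mul (c : ℝ) (F : (Fin n → Fin k) → ℝ) :
    expct p (fun x => c * F x) = c * expct p F := by
  simp only [expct, mul_sum]
  exact sum_congr rfl fun x _ => by ring

theorem expct_sum {ι : Type*} (s : Finset ι) (F : ι → (Fin n → Fin k) → ℝ) :
    expct p (fun x => ∑ i ∈ s, F i x) = ∑ i ∈ s, expct p (F i) := by
  simp only [expct, mul_sum]
  exact sum_comm

theorem expct_mono (hp : ∀ i, 0 ≤ p i) {F G : (Fin n → Fin k) → ℝ} (h : ∀ x, F x ≤ G x) :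
    expct p F ≤ expct p G :=
  sum_le_sum fun x _ => mul_le_mul_of_nonneg_left (h x) (prod_nonneg fun _ _ => hp _)

/-- Fubini for two independent blocks of the sample. -/
theorem expct_append {a b : ℕ} (F : (Fin a → Fin k) → (Fin b → Fin k) → ℝ) :
    expct p (fun x : Fin (a + b) → Fin k =>
      F (fun j => x (Fin.castAdd b j)) (fun j => x (Fin.natAdd a j))) =
      expct p (fun y => expct p (fun z => F y z)) := by
  simp only [expct, mul_sum]
  rw [← Fintype.sum_prod_type']
  refine Fintype.sum_equiv ((Fin.appendEquiv (α := Fin k) a b).symm) _ _ fun x => ?_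
  rw [Fin.prod_univ_add]
  simp [Fin.appendEquiv, mul_assoc]

theorem expct_succ (F : (Fin (n + 1) → Fin k) → ℝ) :
    expct p F = ∑ i, p i * expct p (fun x => F (Fin.cons i x)) := by
  simp only [expct, mul_sum]
  rw [← Fintype.sum_prod_type']
  refine Fintype.sum_equiv (Fin.consEquiv (fun _ => Fin k)).symm _ _ fun x => ?_
  rw [Fin.prod_univ_succ]
  simp [Fin.consEquiv, mul_assoc, Fin.tail]

theorem expct_const (hp : ∑ i, p i = 1) (c : ℝ) :
    expct p (fun _ : Fin n → Fin k => c) = c := by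
  induction n with
  | zero => simp [expct]
  | succ n ih => rw [expct_succ, ih, ← sum_mul, hp, one_mul]

theorem abs_expct_le (hp : ∀ i, 0 ≤ p i) (F : (Fin n → Fin k) → ℝ) :
    |expct p F| ≤ expct p (fun x => |F x|) := by
  refine (abs_sum_le_sum_abs _ _).trans (le_of_eq (sum_congr rfl fun x _ => ?_))
  rw [abs_mul, abs_of_nonneg (prod_nonneg fun j _ => hp _)]

theorem expct_castAdd (hp : ∑ i, p i = 1) {a b : ℕ} (F : (Fin a → Fin k) → ℝ) :
    expct p (fun x : Fin (a + b) → Fin k => F (fun j => x (Fin.castAdd b j))) = expct p F := by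
  rw [expct_append (fun y _ => F y)]
  simp only [expct_const hp]

theorem count_cons (i' : Fin k) (x : Fin n → Fin k) (i : Fin k) :
    count (Fin.cons i' x : Fin (n + 1) → Fin k) i = count x i + if i' = i then 1 else 0 := by
  simp only [count, card_filter]
  rw [Fin.sum_univ_succ]
  simp [add_comm]

theorem expct_count (hp : ∑ i, p i = 1) (i : Fin k) (φ : ℕ → ℝ) :
    expct p (fun x : Fin n → Fin k => φ (count x i)) = binE n (p i) φ := by
  induction n generalizing φ with
  | zero => simp [expct, count, binE_zero]
  | succ n ih =>
    rw [expct_succ, binE_succ, ← ih, ← ih]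
    simp only [count_cons]
    rw [← add_sum_erase _ _ (mem_univ i)]
    have h : ∑ x ∈ univ.erase i, p x * expct p (fun y : Fin n → Fin k =>
        φ (count y i + if x = i then 1 else 0)) =
        ∑ x ∈ univ.erase i, p x * expct p (fun y : Fin n → Fin k => φ (count y i)) := by
      refine sum_congr rfl fun x hx => ?_
      simp [(mem_erase.1 hx).1]
    rw [h, ← sum_mul]
    have : ∑ x ∈ univ.erase i, p x = 1 - p i := by
      rw [← hp, ← add_sum_erase _ _ (mem_univ i)]; ring
    rw [this]; simp

/-- The variance of a function with bounded differences is at most `n * Δ ^ 2`. -/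
theorem expct_sq_sub_le (hp0 : ∀ i, 0 ≤ p i) (hp : ∑ i, p i = 1) {Δ : ℝ}
    (F : (Fin n → Fin k) → ℝ)
    (hF : ∀ x j i, |F (Function.update x j i) - F x| ≤ Δ) :
    expct p (fun x => (F x - expct p F) ^ 2) ≤ n * Δ ^ 2 := by
  induction n with
  | zero => simp [expct, univ_unique]
  | succ n ih =>
    set G : Fin k → ℝ := fun i => expct p (fun x => F (Fin.cons i x)) with hG
    have hEF : expct p F = ∑ i, p i * G i := expct_succ F
    have hGG : ∀ i i', |G i - G i'| ≤ Δ := by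
      intro i i'
      simp only [hG]
      rw [← expct_sub]
      refine (abs_expct_le hp0 _).trans ((expct_mono hp0 fun x => ?_).trans_eq (expct_const hp Δ))
      have := hF (Fin.cons i' x) 0 i
      rwa [Fin.update_cons_zero] at this
    have hGE : ∀ i, |G i - expct p F| ≤ Δ := by
      intro i
      have : G i - expct p F = ∑ i', p i' * (G i - G i') := by
        rw [hEF]; simp only [mul_sub, sum_sub_distrib, ← sum_mul, hp, one_mul]
      rw [this]
      refine (abs_sum_le_sum_abs _ _).trans ?_
      calc _ ≤ ∑ i', p i' * Δ := sum_le_sum fun i' _ => by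
            rw [abs_mul, abs_of_nonneg (hp0 i')]
            exact mul_le_mul_of_nonneg_left (hGG i i') (hp0 i')
        _ = Δ := by rw [← sum_mul, hp, one_mul]
    rw [expct_succ]
    have hi : ∀ i, expct p (fun x : Fin n → Fin k => (F (Fin.cons i x) - expct p F) ^ 2) ≤
        (n + 1 : ℕ) * Δ ^ 2 := by
      intro i
      -- Expansion about the conditional mean `G i` given the first sample; the cross term has mean
      -- zero.
      have e : (fun x : Fin n → Fin k => (F (Fin.cons i x) - expct p F) ^ 2) =
          fun x => ((F (Fin.cons i x) - G i) ^ 2 + 2 * (G i - expct p F) * (F (Fin.cons i x) - G i))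
            + (G i - expct p F) ^ 2 := by ext x; ring
      rw [e, expct_add, expct_add, expct_const_mul, expct_const hp, expct_sub, expct_const hp]
      have h1 := ih (fun x => F (Fin.cons i x)) fun x j i' => by
        have := hF (Fin.cons i x) j.succ i'
        rwa [← Fin.cons_update] at this
      have h2 : (G i - expct p F) ^ 2 ≤ Δ ^ 2 := sq_le_sq' (by linarith [(abs_le.1 (hGE i)).1])
        (abs_le.1 (hGE i)).2
      have h3 : expct p (fun x : Fin n → Fin k => F (Fin.cons i x)) = G i := rfl
      rw [h3] at h1 ⊢
      push_cast
      linarith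
    calc _ ≤ ∑ i, p i * ((n + 1 : ℕ) * Δ ^ 2) :=
          sum_le_sum fun i _ => mul_le_mul_of_nonneg_left (hi i) (hp0 i)
      _ = _ := by rw [← sum_mul, hp, one_mul]

theorem expct_abs_sub_le (hp0 : ∀ i, 0 ≤ p i) (hp : ∑ i, p i = 1) {Δ : ℝ} (hΔ : 0 ≤ Δ)
    (F : (Fin n → Fin k) → ℝ)
    (hF : ∀ x j i, |F (Function.update x j i) - F x| ≤ Δ) :
    expct p (fun x => |F x - expct p F|) ≤ √n * Δ := by
  set V : (Fin n → Fin k) → ℝ := fun x => |F x - expct p F|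
  set c := expct p V with hc
  have h := expct_mono hp0 (F := fun _ => 0) (G := fun x => (V x - c) ^ 2) fun x => sq_nonneg _
  have e : (fun x => (V x - c) ^ 2) = fun x => (V x ^ 2 + (-2 * c) * V x) + c ^ 2 := by
    ext x; ring
  rw [expct_const hp, e, expct_add, expct_add, expct_const_mul, expct_const hp, ← hc] at h
  have hv := expct_sq_sub_le hp0 hp F hF
  have e2 : (fun x => V x ^ 2) = fun x => (F x - expct p F) ^ 2 := by ext x; exact sq_abs _
  rw [e2] at h
  refine (abs_le_of_sq_le_sq' ?_ (by positivity)).2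
  rw [mul_pow, Real.sq_sqrt (Nat.cast_nonneg n)]
  nlinarith

theorem mae_eq_expct (Fhat : (Fin n → Fin k) → ℝ) (F : (Fin k → ℝ) → ℝ) :
    mae Fhat F p = expct p (fun x => |Fhat x - F p|) := rfl

theorem expct_l1Empirical (hp : ∑ i, p i = 1) (q : Fin k → ℝ) :
    expct p (l1Empirical q n) = ∑ i, bern n (q i) (p i) := by
  have : (l1Empirical q n : (Fin n → Fin k) → ℝ) =
      fun x => ∑ i, (fun j : ℕ => |(j : ℝ) / n - q i|) (count x i) := rfl
  rw [this, expct_sum]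
  exact sum_congr rfl fun i _ => expct_count hp i (fun j : ℕ => |(j : ℝ) / n - q i|)

end expct

/-! ### Comparison through means and the two-block estimator -/

/-- Comparison of an estimator with small fluctuations with the empirical estimator through the
means of the two. -/
theorem mae_le_mae_l1Empirical_add {k n m : ℕ} {p q : Fin k → ℝ} (hp0 : ∀ i, 0 ≤ p i)
    (hp : ∑ i, p i = 1) {Δ : ℝ} (hΔ : 0 ≤ Δ) (F : (Fin n → Fin k) → ℝ)
    (hF : ∀ x j i, |F (Function.update x j i) - F x| ≤ Δ) :
    mae F (l1Dist q) p ≤ mae (l1Empirical q m) (l1Dist q) p +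
      (√n * Δ + |expct p F - ∑ i, bern m (q i) (p i)|) := by
  rw [mae_eq_expct, mae_eq_expct]
  set D := l1Dist q p
  have h1 := expct_abs_sub_le hp0 hp hΔ F hF
  -- Jensen: the bias of the empirical estimator is at most its mean absolute error.
  have h2 : |(∑ i, bern m (q i) (p i)) - D| ≤ expct p (fun x => |l1Empirical q m x - D|) := by
    rw [← expct_l1Empirical hp, ← expct_const (n := m) hp D, ← expct_sub]
    simpa only [expct_const hp] using abs_expct_le hp0 _
  have h3 : expct p (fun x => |F x - D|) ≤ expct p (fun x => |F x - expct p F| +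
      (|expct p F - ∑ i, bern m (q i) (p i)| + |(∑ i, bern m (q i) (p i)) - D|)) := by
    refine expct_mono hp0 fun x => ?_
    refine (abs_sub_le _ (expct p F) _).trans ?_
    gcongr
    exact abs_sub_le _ _ _
  rw [expct_add, expct_const hp] at h3
  linarith

/-- Two-stage estimator: symbol by symbol, a statistic of the number of occurrences in the first
and in the second block of `a` samples. -/
noncomputable def blockEst {k : ℕ} (a d : ℕ) (ψ : Fin k → ℕ → ℕ → ℝ) (x : Fin (a + a + d) → Fin k) :
    ℝ :=
  ∑ i, ψ i (count (fun j => x (Fin.castAdd d (Fin.castAdd a j))) i)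
    (count (fun j => x (Fin.castAdd d (Fin.natAdd a j))) i)

theorem expct_blockEst {k a d : ℕ} {p : Fin k → ℝ} (hp : ∑ i, p i = 1)
    (ψ : Fin k → ℕ → ℕ → ℝ) :
    expct p (blockEst a d ψ) = ∑ i, binE a (p i) (fun s => binE a (p i) (fun t => ψ i s t)) := by
  have h1 := expct_castAdd (p := p) hp (b := d) (fun y : Fin (a + a) → Fin k =>
    ∑ i, ψ i (count (fun j => y (Fin.castAdd a j)) i) (count (fun j => y (Fin.natAdd a j)) i))
  refine h1.trans ?_
  rw [expct_sum]
  refine sum_congr rfl fun i _ => ?_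
  rw [expct_append (fun y z => ψ i (count y i) (count z i))]
  have : ∀ s, expct p (fun z : Fin a → Fin k => ψ i s (count z i)) =
      binE a (p i) (fun t => ψ i s t) := fun s => expct_count hp i (ψ i s)
  simp only [this]
  exact expct_count hp i (fun s => binE a (p i) (fun t => ψ i s t))

theorem count_le_count_add_one {k n : ℕ} {x y : Fin n → Fin k} (j : Fin n)
    (h : ∀ t, t ≠ j → x t = y t) (i : Fin k) : count x i ≤ count y i + 1 := by
  refine le_trans (card_le_card ?_) (card_insert_le j _)
  intro t ht
  rw [mem_filter] at ht
  rcases eq_or_ne t j with rfl | htj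
  · exact mem_insert_self _ _
  · exact mem_insert_of_mem (mem_filter.2 ⟨mem_univ _, by rw [← h t htj]; exact ht.2⟩)

/-- Replacing one sample affects only the terms of the old and the new symbol, hence the factor `2`.
The second count is left unrestricted in the hypothesis: a threshold there may flip. -/
theorem abs_blockEst_update_le {k a d : ℕ} (ha : 0 < a) {ψ : Fin k → ℕ → ℕ → ℝ} {Δ : ℝ}
    (hψ : ∀ i s s' t t', s ≤ s' + 1 → s' ≤ s + 1 → |ψ i s t - ψ i s' t'| ≤ Δ)
    (x : Fin (a + a + d) → Fin k) (j : Fin (a + a + d)) (i : Fin k) :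
    |blockEst a d ψ (Function.update x j i) - blockEst a d ψ x| ≤ 2 * Δ := by
  set y := Function.update x j i with hy
  have hΔ : 0 ≤ Δ := (abs_nonneg _).trans (hψ i 0 0 0 0 (by omega) (by omega))
  have hoff : ∀ t, t ≠ j → y t = x t := fun t ht => Function.update_of_ne ht _ _
  -- If the replaced sample lies outside the first block, that block is unchanged and index `0`
  -- serves as a dummy.
  have hnear : ∃ t0 : Fin a, ∀ t, t ≠ t0 → y (Fin.castAdd d (Fin.castAdd a t)) =
      x (Fin.castAdd d (Fin.castAdd a t)) := by
    by_cases h : ∃ t0 : Fin a, Fin.castAdd d (Fin.castAdd a t0) = j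
    · obtain ⟨t0, ht0⟩ := h
      refine ⟨t0, fun t ht => hoff _ fun h => ht ?_⟩
      rw [← ht0] at h
      exact Fin.castAdd_injective _ _ (Fin.castAdd_injective _ _ h)
    · push Not at h
      exact ⟨⟨0, ha⟩, fun t _ => hoff _ (h t)⟩
  obtain ⟨t0, ht0⟩ := hnear
  rw [blockEst, blockEst, ← sum_sub_distrib]
  refine (abs_sum_le_sum_abs _ _).trans ?_
  have hterm : ∀ i' : Fin k, |ψ i' (count (fun t => y (Fin.castAdd d (Fin.castAdd a t))) i')
      (count (fun t => y (Fin.castAdd d (Fin.natAdd a t))) i') -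
      ψ i' (count (fun t => x (Fin.castAdd d (Fin.castAdd a t))) i')
      (count (fun t => x (Fin.castAdd d (Fin.natAdd a t))) i')| ≤
      (if i' = x j then Δ else 0) + (if i' = i then Δ else 0) := by
    intro i'
    by_cases h1 : i' = x j ∨ i' = i
    · refine (hψ i' _ _ _ _ (count_le_count_add_one t0 ht0 i')
        (count_le_count_add_one t0 (fun t ht => (ht0 t ht).symm) i')).trans ?_
      rcases h1 with h | h
      · rw [if_pos h]; split_ifs <;> linarith
      · rw [if_pos h]; split_ifs <;> linarith
    · push Not at h1
      have hiff : ∀ t, y t = i' ↔ x t = i' := by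
        intro t
        rcases eq_or_ne t j with rfl | ht
        · rw [hy, Function.update_self]
          exact ⟨fun h => absurd h.symm h1.2, fun h => absurd h.symm h1.1⟩
        · rw [hoff t ht]
      simp only [count, hiff, sub_self, abs_zero]
      split_ifs <;> linarith
  refine (sum_le_sum fun i' _ => hterm i').trans (le_of_eq ?_)
  rw [sum_add_distrib, sum_ite_eq', sum_ite_eq']
  simp; ring

/-! ### Unbiased estimation of polynomials -/

/-- The unbiased estimator of `∑ r < d, γ r * p ^ (r + 1)` from `a` samples. -/
noncomputable def polyStat (a d : ℕ) (γ : ℕ → ℝ) (j : ℕ) : ℝ :=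
  ∑ r ∈ range d, γ r / a.choose (r + 1) * (j.choose (r + 1) : ℝ)

theorem binE_polyStat {a d : ℕ} (hd : d ≤ a) (γ : ℕ → ℝ) (p : ℝ) :
    binE a p (polyStat a d γ) = ∑ r ∈ range d, γ r * p ^ (r + 1) := by
  change binE a p (fun j => ∑ r ∈ range d, γ r / a.choose (r + 1) * (j.choose (r + 1) : ℝ)) = _
  rw [binE_sum]
  refine sum_congr rfl fun r hr => ?_
  rw [binE_const_mul, binE_choose]
  have : (a.choose (r + 1) : ℝ) ≠ 0 := by
    have := Nat.choose_pos (show r + 1 ≤ a by have := mem_range.1 hr; omega)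
    positivity
  field_simp

/-- Each factor `(j - i) / (a - i)` of the ratio of binomial coefficients is at most `j / a`;
written without division. -/
theorem choose_mul_pow_le {j a : ℕ} (h : j ≤ a) (r : ℕ) :
    j.choose r * a ^ r ≤ j ^ r * a.choose r := by
  induction r with
  | zero => simp
  | succ r ih =>
    have h1 := Nat.choose_succ_right_eq j r
    have h2 := Nat.choose_succ_right_eq a r
    have h3 : (j - r) * a ≤ j * (a - r) := by
      rw [Nat.sub_mul, Nat.mul_sub]
      have : j * r ≤ r * a := by rw [mul_comm]; exact Nat.mul_le_mul_left _ h
      omega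
    refine Nat.le_of_mul_le_mul_right ?_ (Nat.succ_pos r)
    calc j.choose (r + 1) * a ^ (r + 1) * (r + 1) = (j.choose (r + 1) * (r + 1)) * a ^ (r + 1) := by
          ring
      _ = (j.choose r * a ^ r) * ((j - r) * a) := by rw [h1]; ring
      _ ≤ (j ^ r * a.choose r) * (j * (a - r)) := Nat.mul_le_mul ih h3
      _ = j ^ (r + 1) * (a.choose r * (a - r)) := by ring
      _ = j ^ (r + 1) * a.choose (r + 1) * (r + 1) := by rw [← h2]; ring

theorem choose_div_choose_le {j a r : ℕ} (h : j ≤ a) (hr : r ≤ a) (ha : 0 < a) :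
    (j.choose r : ℝ) / a.choose r ≤ ((j : ℝ) / a) ^ r := by
  have hc : (0 : ℝ) < a.choose r := by exact_mod_cast Nat.choose_pos hr
  have ha' : (0 : ℝ) < a := by exact_mod_cast ha
  rw [div_pow, div_le_div_iff₀ hc (by positivity)]
  exact_mod_cast choose_mul_pow_le h r

/-- Since the polynomial has no constant term, a factor `j / a` splits off; each remaining power of
`j / (a * B)` costs at most `4`. -/
theorem abs_polyStat_le {a d j : ℕ} (hd : d ≤ a) (ha : 0 < a) {B W : ℝ} (hB : 0 < B)
    {β γ : ℕ → ℝ} (hγ : ∀ r, |γ r| ≤ |β r| / B ^ r) (hW : ∑ r ∈ range d, |β r| ≤ W)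
    (hja : j ≤ a) (hj : (j : ℝ) ≤ 4 * (a * B)) :
    |polyStat a d γ j| ≤ (j : ℝ) / a * (W * 4 ^ d) := by
  have ha' : (0 : ℝ) < a := by exact_mod_cast ha
  refine (abs_sum_le_sum_abs _ _).trans ?_
  have hterm : ∀ r ∈ range d, |γ r / a.choose (r + 1) * (j.choose (r + 1) : ℝ)| ≤
      (j : ℝ) / a * 4 ^ d * |β r| := by
    intro r hr
    have hr' := mem_range.1 hr
    rw [abs_mul, abs_div, Nat.abs_cast, Nat.abs_cast, div_mul_eq_mul_div, mul_div_assoc]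
    have hx : (j : ℝ) / a / B ≤ 4 := by
      rw [div_div, div_le_iff₀ (by positivity)]; exact hj
    calc _ ≤ |β r| / B ^ r * ((j : ℝ) / a) ^ (r + 1) :=
          mul_le_mul (hγ r) (choose_div_choose_le hja (by omega) ha) (by positivity) (by positivity)
      _ = (j : ℝ) / a * ((j : ℝ) / a / B) ^ r * |β r| := by
          rw [div_pow ((j : ℝ) / a) B, pow_succ]; ring
      _ ≤ (j : ℝ) / a * 4 ^ r * |β r| := by gcongr
      _ ≤ _ := by
          gcongr
          norm_num
  refine (sum_le_sum hterm).trans ?_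
  rw [← mul_sum, mul_assoc, mul_comm W]
  gcongr

theorem one_add_pow_le_exp {p : ℝ} (hp : 0 ≤ p) {s a : ℕ} (hs : s ≤ a) :
    (1 - p + 2 * p) ^ s ≤ Real.exp (a * p) := by
  rw [Real.exp_nat_mul]
  refine (pow_le_pow_right₀ (by linarith) hs).trans (pow_le_pow_left₀ (by linarith) ?_ _)
  linarith [Real.add_one_le_exp p]

/-- The indicator of `j > t` is at most `2 ^ (j - t)`, after which tilted factorial moments at `z =
2` apply. The absent constant term leaves the factor `p`, so the bound can be summed over symbols.
-/
theorem binE_polyStat_tail_le {a d : ℕ} (hd : d ≤ a) (ha : 0 < a) {B W t p : ℝ} (hB : 0 < B)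
    (hp : 0 ≤ p) (hpB : p ≤ B) (hp1 : p ≤ 1)
    {β γ : ℕ → ℝ} (hγ : ∀ r, |γ r| ≤ |β r| / B ^ r) (hW : ∑ r ∈ range d, |β r| ≤ W) :
    binE a p (fun j => if (j : ℝ) ≤ t then 0 else |polyStat a d γ j| + (j : ℝ) / a) ≤
      2 ^ (-t) * Real.exp (a * p) * (2 * (1 + W * 2 ^ d)) * p := by
  have ha' : (0 : ℝ) < a := by exact_mod_cast ha
  have h2t : (0 : ℝ) < 2 ^ (-t) := by positivity
  have hdom : ∀ j : ℕ, (if (j : ℝ) ≤ t then 0 else |polyStat a d γ j| + (j : ℝ) / a) ≤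
      2 ^ (-t) * ((∑ r ∈ range d, |γ r| / a.choose (r + 1) * ((j.choose (r + 1) : ℝ) * 2 ^ j)) +
        (1 / a) * ((j.choose 1 : ℝ) * 2 ^ j)) := by
    intro j
    split_ifs with h
    · positivity
    · push Not at h
      have h1 : (1 : ℝ) ≤ 2 ^ (-t) * 2 ^ j := by
        rw [← Real.rpow_natCast, ← Real.rpow_add two_pos]
        exact Real.one_le_rpow (by norm_num) (by linarith)
      have h2 : |polyStat a d γ j| ≤ ∑ r ∈ range d, |γ r| / a.choose (r + 1) *
          (j.choose (r + 1) : ℝ) := by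
        refine (abs_sum_le_sum_abs _ _).trans (le_of_eq (sum_congr rfl fun r _ => ?_))
        rw [abs_mul, abs_div, Nat.abs_cast, Nat.abs_cast]
      have e : 2 ^ (-t) * ((∑ r ∈ range d, |γ r| / a.choose (r + 1) *
          ((j.choose (r + 1) : ℝ) * 2 ^ j)) + (1 / a) * ((j.choose 1 : ℝ) * 2 ^ j)) =
          ((∑ r ∈ range d, |γ r| / a.choose (r + 1) * (j.choose (r + 1) : ℝ)) + (j : ℝ) / a) *
          (2 ^ (-t) * 2 ^ j) := by
        simp only [← mul_assoc, ← sum_mul]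
        rw [Nat.choose_one_right]; ring
      rw [e]
      refine le_trans (add_le_add_left h2 _) (le_mul_of_one_le_right (by positivity) h1)
  refine (binE_mono hp hp1 hdom).trans ?_
  rw [binE_const_mul, binE_add, binE_sum, binE_const_mul, binE_choose_mul_pow]
  have hterm : ∀ r ∈ range d, binE a p (fun j => |γ r| / a.choose (r + 1) *
      ((j.choose (r + 1) : ℝ) * 2 ^ j)) ≤ 2 * p * 2 ^ d * Real.exp (a * p) * |β r| := by
    intro r hr
    have hr' := mem_range.1 hr
    have hc : (0 : ℝ) < a.choose (r + 1) := by
      exact_mod_cast Nat.choose_pos (show r + 1 ≤ a by omega)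
    rw [binE_const_mul, binE_choose_mul_pow]
    have hE := one_add_pow_le_exp hp (s := a - (r + 1)) (a := a) (by omega)
    calc _ = |γ r| * (2 * p) ^ (r + 1) * (1 - p + 2 * p) ^ (a - (r + 1)) := by field_simp
      _ ≤ |β r| / B ^ r * (2 * p) ^ (r + 1) * Real.exp (a * p) := by
          gcongr
          exact hγ r
      _ = 2 * p * 2 ^ r * Real.exp (a * p) * |β r| * (p / B) ^ r := by
          rw [div_pow, mul_pow, pow_succ, pow_succ]; ring
      _ ≤ 2 * p * 2 ^ r * Real.exp (a * p) * |β r| :=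
          mul_le_of_le_one_right (by positivity)
            (pow_le_one₀ (by positivity) ((div_le_one hB).2 hpB))
      _ ≤ _ := by
          gcongr
          norm_num
  have h1 : ∑ r ∈ range d, binE a p (fun j => |γ r| / a.choose (r + 1) *
      ((j.choose (r + 1) : ℝ) * 2 ^ j)) ≤ 2 * p * 2 ^ d * Real.exp (a * p) * W := by
    refine (sum_le_sum hterm).trans ?_
    rw [← mul_sum]
    gcongr
  have h2 : 1 / (a : ℝ) * (a.choose 1 * (2 * p) ^ 1 * (1 - p + 2 * p) ^ (a - 1)) ≤
      2 * p * Real.exp (a * p) := by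
    have hE := one_add_pow_le_exp hp (s := a - 1) (a := a) (by omega)
    rw [Nat.choose_one_right, pow_one, ← mul_assoc, ← mul_assoc, one_div_mul_cancel ha'.ne', one_mul]
    gcongr
  calc _ ≤ 2 ^ (-t) * (2 * p * 2 ^ d * Real.exp (a * p) * W + 2 * p * Real.exp (a * p)) := by
        gcongr
    _ = _ := by ring

/-! ### The correction statistic -/

theorem binE_at_zero (n : ℕ) (φ : ℕ → ℝ) : binE n 0 φ = φ 0 := by
  induction n with
  | zero => rfl
  | succ n ih => rw [binE_succ, ih]; ring

/-- The derivative of `bern (m + 1) q`. -/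
noncomputable def bernDeriv (m : ℕ) (q x : ℝ) : ℝ :=
  binE m x (fun j => (m + 1) * (|((j + 1 : ℕ) : ℝ) / (m + 1 : ℕ) - q| - |(j : ℝ) / (m + 1 : ℕ) - q|))

theorem hasDerivAt_bern (m : ℕ) (q x : ℝ) :
    HasDerivAt (bern (m + 1) q) (bernDeriv m q x) x := by
  rw [bernDeriv, binE_const_mul]
  exact hasDerivAt_binE m _ x

theorem abs_bernDeriv_integrand_le (m j : ℕ) (q : ℝ) :
    |((m : ℝ) + 1) * (|((j + 1 : ℕ) : ℝ) / (m + 1 : ℕ) - q| - |(j : ℝ) / (m + 1 : ℕ) - q|)| ≤ 1 := by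
  have hm : (0 : ℝ) < (m : ℝ) + 1 := by positivity
  rw [abs_mul, abs_of_pos hm]
  have := abs_abs_sub_abs_le (((j + 1 : ℕ) : ℝ) / (m + 1 : ℕ) - q) ((j : ℝ) / (m + 1 : ℕ) - q)
  have e : ((j + 1 : ℕ) : ℝ) / (m + 1 : ℕ) - q - ((j : ℝ) / (m + 1 : ℕ) - q) = 1 / (m + 1) := by
    push_cast; field_simp; ring
  rw [e, abs_of_pos (show (0 : ℝ) < 1 / (m + 1) by positivity)] at this
  calc _ ≤ ((m : ℝ) + 1) * (1 / (m + 1)) := mul_le_mul_of_nonneg_left this hm.le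
    _ = 1 := by field_simp

-- The mean value inequality: the integrated polynomial and the Bernstein polynomial both equal `q`
-- at `0`, so a uniform error in the derivative becomes an error proportional to `p`.
open Polynomial in
theorem abs_integral_sub_bern_le {d m : ℕ} {B q e p : ℝ} (hB : 0 < B) (hq : 0 ≤ q) {Q : ℝ[X]}
    (hQ : Q.natDegree < d)
    (h : ∀ u ∈ Set.Icc (0 : ℝ) 1, |Q.eval u - bernDeriv m q (B * u)| ≤ e)
    (hp : 0 ≤ p) (hpB : p ≤ B) :
    |q + ∑ r ∈ range d, Q.coeff r / (B ^ r * (r + 1)) * p ^ (r + 1) - bern (m + 1) q p| ≤ e * p := by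
  set Φ : ℝ → ℝ := fun x => q + ∑ r ∈ range d, Q.coeff r / (B ^ r * (r + 1)) * x ^ (r + 1) -
    bern (m + 1) q x with hΦ
  have hd : ∀ x, HasDerivAt Φ (Q.eval (x / B) - bernDeriv m q x) x := by
    intro x
    have h1 : HasDerivAt (fun x : ℝ => ∑ r ∈ range d, Q.coeff r / (B ^ r * (r + 1)) * x ^ (r + 1))
        (∑ r ∈ range d, Q.coeff r / (B ^ r * (r + 1)) * (((r + 1 : ℕ) : ℝ) * x ^ r)) x :=
      HasDerivAt.fun_sum fun r _ => (hasDerivAt_pow (r + 1) x).const_mul _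
    refine ((h1.const_add q).sub (hasDerivAt_bern m q x)).congr_deriv ?_
    rw [eval_eq_sum_range' hQ]
    congr 1
    refine sum_congr rfl fun r _ => ?_
    have : (0 : ℝ) < (r : ℝ) + 1 := by positivity
    push_cast
    rw [div_pow]; field_simp
  have h0 : Φ 0 = 0 := by
    simp only [hΦ, bern, binE_at_zero]
    simp [abs_of_nonneg hq]
  have := (convex_Icc (0 : ℝ) p).norm_image_sub_le_of_norm_hasDerivWithin_le (f := Φ) (C := e)
    (fun x _ => (hd x).hasDerivWithinAt) (fun x hx => ?_) (Set.left_mem_Icc.2 hp)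
    (Set.right_mem_Icc.2 hp)
  · rw [h0, sub_zero, sub_zero, Real.norm_eq_abs, Real.norm_eq_abs, abs_of_nonneg hp] at this
    exact this
  · have := h (x / B) ⟨div_nonneg hx.1 hB.le, (div_le_one hB).2 (hx.2.trans hpB)⟩
    rw [mul_div_cancel₀ _ hB.ne'] at this
    exact this

/-- A bounded statistic of the number of occurrences among `a` samples whose mean corrects
`bern a q` to `bern m q` on `[0, K / a]`. -/
theorem exists_correction {a N m : ℕ} {q K : ℝ} (hN : 1 ≤ N) (hNa : 2 * N ≤ a) (hm : 0 < m)
    (hK : 0 < K) (hKa : 4 * K ≤ a) (hq : 0 ≤ q) :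
    ∃ v : ℕ → ℝ, (∀ j, |v j| ≤ 4 * K / a * (1 + 2 * N * 7 ^ (2 * N) * 4 ^ (2 * N))) ∧
      ∀ p, 0 ≤ p → p ≤ K / a → |binE a p v - (bern m q p - bern a q p)| ≤
        4 * √(2 * m) * √(K / a) / N * p +
        2 ^ (-(4 * K)) * Real.exp K * (2 * (1 + 2 * N * 7 ^ (2 * N) * 2 ^ (2 * N))) * p := by
  obtain ⟨m, rfl⟩ : ∃ m', m = m' + 1 := ⟨m - 1, by omega⟩
  have ha : 0 < a := by omega
  have ha' : (0 : ℝ) < a := by exact_mod_cast ha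
  set B := K / a with hBdef
  have hB : 0 < B := by positivity
  have hB4 : B ≤ 1 / 4 := by rw [hBdef, div_le_iff₀ ha']; linarith
  have haB : a * B = K := by rw [hBdef]; field_simp
  set W : ℝ := 2 * N * 7 ^ (2 * N) with hWdef
  set Λ := 2 * √(2 * (m + 1 : ℕ)) * √B with hΛ
  -- Rescaling `[0, B]` to `[0, 1]` multiplies the Hellinger–Lipschitz constant by `√B`; `B ≤ 1 / 4`
  -- keeps the parameters in the range of `abs_binE_sub_le`.
  obtain ⟨Q, hQd, hQW, hQe⟩ := exists_jackson_polynomial hN (G := fun u => bernDeriv m q (B * u))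
    (Λ := Λ) (fun u hu => abs_binE_le_of_abs_le (mul_nonneg hB.le hu.1)
      (by nlinarith [hu.2]) fun j => abs_bernDeriv_integrand_le m j q)
    (fun u hu v hv => by
      refine (abs_binE_sub_le m (mul_nonneg hB.le hu.1) (by nlinarith [hu.2])
        (mul_nonneg hB.le hv.1) (by nlinarith [hv.2])
        fun j => abs_bernDeriv_integrand_le m j q).trans ?_
      rw [Real.sqrt_mul hB.le, Real.sqrt_mul hB.le, ← mul_sub, abs_mul,
        abs_of_nonneg (Real.sqrt_nonneg B), hΛ, ← mul_assoc]
      have : √(2 * m : ℝ) ≤ √(2 * (m + 1 : ℕ)) := Real.sqrt_le_sqrt (by push_cast; linarith)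
      gcongr)
  set γ : ℕ → ℝ := fun r => Q.coeff r / (B ^ r * (r + 1)) with hγdef
  have hγ : ∀ r, |γ r| ≤ |Q.coeff r| / B ^ r := by
    intro r
    rw [hγdef, abs_div, abs_of_pos (by positivity : 0 < B ^ r * ((r : ℝ) + 1))]
    have : (0 : ℝ) ≤ r := Nat.cast_nonneg r
    gcongr
    exact le_mul_of_one_le_right (by positivity) (by linarith)
  -- The integrated polynomial estimated without bias, minus the plug-in term. As `q - |j / a - q|`
  -- is at most `j / a` in absolute value, `u` is small at small counts.
  set u : ℕ → ℝ := fun j => q + polyStat a (2 * N) γ j - |(j : ℝ) / a - q| with hu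
  have hu1 : ∀ j, |u j| ≤ |polyStat a (2 * N) γ j| + (j : ℝ) / a := by
    intro j
    have hj : 0 ≤ (j : ℝ) / a := by positivity
    have h1 : |q - (|(j : ℝ) / a - q|)| ≤ (j : ℝ) / a := by
      rw [abs_le]
      constructor
      · rcases abs_cases ((j : ℝ) / a - q) with h | h <;> linarith
      · rcases abs_cases ((j : ℝ) / a - q) with h | h <;> linarith
    have e : u j = polyStat a (2 * N) γ j + (q - |(j : ℝ) / a - q|) := by simp only [hu]; ring
    rw [e]
    exact (abs_add_le _ _).trans (by linarith)
  -- For `p ≤ K / a` the mean count is at most `K`. Cutting at `4 * K` bounds the statistic and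
  -- loses only the tail, where `2 ^ (-(4 * K))` beats `exp K`.
  refine ⟨fun j => if (j : ℝ) ≤ 4 * K then u j else 0, fun j => ?_, fun p hp hpB => ?_⟩
  · beta_reduce
    split_ifs with h
    · have hja : j ≤ a := by exact_mod_cast h.trans hKa
      have h1 := abs_polyStat_le hNa ha hB hγ hQW hja (by rw [haB]; exact h)
      calc _ ≤ (j : ℝ) / a * (W * 4 ^ (2 * N)) + (j : ℝ) / a := (hu1 j).trans (by linarith)
        _ = (j : ℝ) / a * (1 + W * 4 ^ (2 * N)) := by ring
        _ ≤ _ := by gcongr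
    · rw [abs_zero]; positivity
  · have hp1 : p ≤ 1 := by linarith
    have e1 : binE a p (fun j => if (j : ℝ) ≤ 4 * K then u j else 0) =
        binE a p u - binE a p (fun j => if (j : ℝ) ≤ 4 * K then 0 else u j) := by
      rw [← binE_sub]
      congr 1; ext j; split_ifs <;> simp
    have e2 : binE a p u = q + ∑ r ∈ range (2 * N), γ r * p ^ (r + 1) - bern a q p := by
      simp only [hu]
      rw [binE_sub, binE_add, binE_const, binE_polyStat hNa, bern]
    have b1 := abs_integral_sub_bern_le (p := p) hB hq hQd hQe hp hpB
    have b2 : |binE a p (fun j => if (j : ℝ) ≤ 4 * K then 0 else u j)| ≤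
        2 ^ (-(4 * K)) * Real.exp K * (2 * (1 + W * 2 ^ (2 * N))) * p := by
      refine (abs_binE_le hp hp1 _).trans ?_
      have h3 : ∀ j : ℕ, |if (j : ℝ) ≤ 4 * K then 0 else u j| ≤ if (j : ℝ) ≤ 4 * K then 0 else
          |polyStat a (2 * N) γ j| + (j : ℝ) / a := by
        intro j; split_ifs
        · simp
        · exact hu1 j
      refine (binE_mono hp hp1 h3).trans
        ((binE_polyStat_tail_le hNa ha hB hp hpB hp1 hγ hQW).trans ?_)
      have : (a : ℝ) * p ≤ K := by rw [← haB]; gcongr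
      gcongr
    rw [e1, e2]
    set S := ∑ r ∈ range (2 * N), γ r * p ^ (r + 1)
    set R := binE a p (fun j => if (j : ℝ) ≤ 4 * K then 0 else u j)
    have e3 : q + S - bern a q p - R - (bern (m + 1) q p - bern a q p) =
        (q + S - bern (m + 1) q p) - R := by ring
    rw [e3]
    refine (abs_sub _ _).trans (add_le_add (b1.trans (le_of_eq ?_)) b2)
    rw [hΛ]; ring

/-! ### Switching the correction on and off -/

/-- The probability that a binomial variable with parameters `a` and `p` is at most `T`. -/
noncomputable def lowProb (a : ℕ) (p T : ℝ) : ℝ :=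
  binE a p (fun t => if (t : ℝ) ≤ T then 1 else 0)

section lowProb

variable {a : ℕ} {p : ℝ} (T : ℝ)

theorem lowProb_nonneg (h0 : 0 ≤ p) (h1 : p ≤ 1) : 0 ≤ lowProb a p T :=
  binE_nonneg h0 h1 fun j => by split_ifs <;> norm_num

theorem lowProb_le_one (h0 : 0 ≤ p) (h1 : p ≤ 1) : lowProb a p T ≤ 1 :=
  (binE_mono h0 h1 (ψ := fun _ => 1) fun j => by split_ifs <;> norm_num).trans_eq
    (binE_const a p 1)

/-- Markov's inequality for `(1 / 2) ^ t`; `one_sub_lowProb_le` uses `2 ^ t` for the opposite tail.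
-/
theorem lowProb_le (h0 : 0 ≤ p) (h1 : p ≤ 1) :
    lowProb a p T ≤ 2 ^ T * Real.exp (-(a * p / 2)) := by
  have h : ∀ t : ℕ, (if (t : ℝ) ≤ T then (1 : ℝ) else 0) ≤ 2 ^ T * (1 / 2) ^ t := by
    intro t
    split_ifs with ht
    · rw [one_div, inv_pow, ← Real.rpow_natCast, ← Real.rpow_neg two_pos.le,
        ← Real.rpow_add two_pos]
      exact Real.one_le_rpow (by norm_num) (by linarith)
    · positivity
  refine (binE_mono h0 h1 h).trans ?_
  rw [binE_const_mul, binE_pow, show -(a * p / 2) = a * (-(p / 2)) by ring, Real.exp_nat_mul]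
  gcongr
  linarith [Real.add_one_le_exp (-(p / 2))]

theorem one_sub_lowProb_le (h0 : 0 ≤ p) (h1 : p ≤ 1) :
    1 - lowProb a p T ≤ 2 ^ (-T) * Real.exp (a * p) := by
  have h : ∀ t : ℕ, 1 - (if (t : ℝ) ≤ T then (1 : ℝ) else 0) ≤ 2 ^ (-T) * 2 ^ t := by
    intro t
    split_ifs with ht
    · rw [sub_self]; positivity
    · rw [← Real.rpow_natCast, ← Real.rpow_add two_pos, sub_zero]
      exact Real.one_le_rpow (by norm_num) (by linarith)
  have e : 1 - lowProb a p T = binE a p (fun t => 1 - if (t : ℝ) ≤ T then (1 : ℝ) else 0) := by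
    rw [binE_sub, binE_const, lowProb]
  rw [e]
  refine (binE_mono h0 h1 h).trans ?_
  rw [binE_const_mul, binE_pow]
  gcongr
  exact one_add_pow_le_exp h0 le_rfl

end lowProb

/-- Either `w ^ 2 ≤ 4 / ε ^ 2`, so `ε * w ≤ 2`, or the bound on `π` is at most `exp (-(w ^ 2 / 4))`,
which beats the linear growth. -/
theorem mul_scaled_le_four {ε w π : ℝ} (hε : 0 < ε) (hε1 : ε ≤ 1) (hw : 0 ≤ w) (hπ1 : π ≤ 1)
    (hπ : π ≤ Real.exp (Real.log 2 * (1 / ε ^ 2) + -(w ^ 2 / 2))) : π * (ε * w) ≤ 4 := by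
  set T := 1 / ε ^ 2 with hT
  have hε2 : 0 < ε ^ 2 := by positivity
  have hTε : T * ε ^ 2 = 1 := by rw [hT]; field_simp
  have hT1 : 1 ≤ T := by rw [hT, le_div_iff₀ hε2]; nlinarith
  have hl2 := Real.log_two_lt_d9
  rcases le_or_gt (w ^ 2) (4 * T) with h3 | h3
  · have : (ε * w) ^ 2 ≤ 4 := by rw [mul_pow]; nlinarith
    have h4 : ε * w ≤ 2 := by nlinarith
    calc _ ≤ 1 * 2 := mul_le_mul hπ1 h4 (by positivity) (by norm_num)
      _ ≤ 4 := by norm_num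
  · have h4 : Real.log 2 * T + -(w ^ 2 / 2) ≤ -(w ^ 2 / 4) := by
        have := mul_le_mul_of_nonneg_right hl2.le (zero_le_one.trans hT1)
        linarith
    have h5 := hπ.trans (Real.exp_le_exp.2 h4)
    rw [Real.exp_neg] at h5
    have h6 : w ^ 2 / 4 ≤ Real.exp (w ^ 2 / 4) := by linarith [Real.add_one_le_exp (w ^ 2 / 4)]
    have hw1 : 1 ≤ w := by
      by_contra! hlt
      have : w ^ 2 ≤ 1 := pow_le_one₀ hw hlt.le
      linarith
    have h7 : ε * w ≤ w ^ 2 := by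
      rw [sq]; exact mul_le_mul_of_nonneg_right (hε1.trans hw1) hw
    calc π * (ε * w) ≤ (w ^ 2 / 4)⁻¹ * w ^ 2 :=
          mul_le_mul (h5.trans (inv_anti₀ (by linarith) h6)) h7 (by positivity) (by positivity)
      _ = 4 := by
          have : w ^ 2 ≠ 0 := by linarith
          field_simp

/-- The mixture bound: `π` weighs a correction `V` of `X` that is accurate to relative order `ε`. -/
theorem abs_mixture_le {ε w s π C τ V X : ℝ} (hε : 0 < ε) (hε1 : ε ≤ 1) (hw : 0 ≤ w)
    (hs : 0 ≤ s) (hπ0 : 0 ≤ π) (hπ1 : π ≤ 1)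
    (hπ : π ≤ 2 ^ (1 / ε ^ 2) * Real.exp (-(w ^ 2 / 2)))
    (hπ' : 1 - π ≤ 2 ^ (-(1 / ε ^ 2)) * Real.exp (w ^ 2))
    (hX : |X| ≤ 2 * s) (hX' : |X| ≤ 4 * (w * s)) (hC : 0 ≤ C) (hτ : 0 ≤ τ)
    (hV : |V - X| ≤ C * (ε * (w * s)) + τ) :
    |π * V - X| ≤ (16 * C + 8) * min (ε * (w * s)) s + τ := by
  set T := 1 / ε ^ 2 with hT
  have hε2 : 0 < ε ^ 2 := by positivity
  have hTε : T * ε ^ 2 = 1 := by rw [hT]; field_simp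
  have hT1 : 1 ≤ T := by rw [hT, le_div_iff₀ hε2]; nlinarith
  have hl1 := Real.log_two_gt_d9
  rw [Real.rpow_def_of_pos two_pos, ← Real.exp_add] at hπ hπ'
  have h1 : |π * V - X| ≤ π * |V - X| + (1 - π) * |X| := by
    have e : π * V - X = π * (V - X) - (1 - π) * X := by ring
    rw [e]
    refine (abs_sub _ _).trans (le_of_eq ?_)
    rw [abs_mul, abs_mul, abs_of_nonneg hπ0, abs_of_nonneg (by linarith : 0 ≤ 1 - π)]
  have hws : 0 ≤ w * s := mul_nonneg hw hs
  have hεws : 0 ≤ ε * (w * s) := by positivity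
  have h2 : π * |V - X| ≤ C * (π * (ε * (w * s))) + τ := by
    have := mul_le_mul_of_nonneg_left hV hπ0
    nlinarith [mul_le_of_le_one_left hτ hπ1]
  -- In the application `w = √(a * p)` and `s = √(p / a)`, so `w * s = p`. For small `ε * w` the
  -- correction is almost surely on and `1 - π ≤ 2 * ε`. Otherwise `s` is within a factor `4` of the
  -- minimum, and the decay of `π` tames the correction's error.
  rcases le_or_gt ((ε * w) ^ 2) (1 / 10) with h | h
  · have hw2 : w ^ 2 ≤ T / 10 := by
      rw [mul_pow] at h
      have : w ^ 2 = T * (ε ^ 2 * w ^ 2) := by rw [← mul_assoc, hTε, one_mul]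
      rw [this]; nlinarith
    have hq : 1 - π ≤ 2 * ε := by
      refine hπ'.trans ?_
      have h3 : Real.log 2 * -T + w ^ 2 ≤ -(T / 2) := by
        have := mul_le_mul_of_nonneg_right hl1.le (zero_le_one.trans hT1)
        linarith
      refine (Real.exp_le_exp.2 h3).trans ?_
      rw [Real.exp_neg]
      have h4 : T / 2 ≤ Real.exp (T / 2) := by linarith [Real.add_one_le_exp (T / 2)]
      calc (Real.exp (T / 2))⁻¹ ≤ (T / 2)⁻¹ := inv_anti₀ (by linarith) h4
        _ = 2 * ε ^ 2 := by rw [hT]; field_simp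
        _ ≤ 2 * ε := by nlinarith
    have hεw : ε * w ≤ 1 := by nlinarith [mul_nonneg hε.le hw]
    have hmin : min (ε * (w * s)) s = ε * (w * s) := by
      apply min_eq_left
      rw [← mul_assoc]; exact mul_le_of_le_one_left hs hεw
    rw [hmin]
    have h5 : (1 - π) * |X| ≤ 2 * ε * (4 * (w * s)) :=
      mul_le_mul hq hX' (abs_nonneg _) (by positivity)
    have h6 : π * (ε * (w * s)) ≤ ε * (w * s) := mul_le_of_le_one_left hεws hπ1
    nlinarith [mul_le_mul_of_nonneg_left h6 hC, mul_nonneg hC hεws]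
  · have hεw : 1 / 4 ≤ ε * w := by nlinarith [mul_nonneg hε.le hw]
    have hs4 : s ≤ 4 * (ε * (w * s)) := by nlinarith
    have hmin : s / 4 ≤ min (ε * (w * s)) s := le_min (by linarith) (by linarith)
    have hπw := mul_scaled_le_four hε hε1 hw hπ1 hπ
    have h8 : π * (ε * (w * s)) ≤ 4 * s := by
      calc _ = π * (ε * w) * s := by ring
        _ ≤ 4 * s := mul_le_mul_of_nonneg_right hπw hs
    have h9 : (1 - π) * |X| ≤ 2 * s :=
      (mul_le_of_le_one_left (abs_nonneg X) (by linarith)).trans hX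
    have h10 := mul_le_mul_of_nonneg_left h8 hC
    have h11 := mul_le_mul_of_nonneg_left hmin hC
    linarith

theorem abs_bern_sub_bern_le_sqrt {a m : ℕ} (ha : 0 < a) (ham : a ≤ m) {p : ℝ} (q : ℝ)
    (h0 : 0 ≤ p) (h1 : p ≤ 1) : |bern m q p - bern a q p| ≤ 2 * √(p / a) := by
  have hm : √(p / m) ≤ √(p / a) := by
    have : (0 : ℝ) < a := by exact_mod_cast ha
    apply Real.sqrt_le_sqrt; gcongr
  have e1 := (abs_bern_sub_le m q h0 h1).trans (binE_abs_sub_le_sqrt (by omega) h0 h1)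
  have e2 := (abs_bern_sub_le a q h0 h1).trans (binE_abs_sub_le_sqrt ha h0 h1)
  rw [abs_le] at *
  constructor <;> linarith

theorem abs_bern_sub_bern_le_mul {a m : ℕ} (ha : 0 < a) (ham : a ≤ m) {p : ℝ} (q : ℝ)
    (h0 : 0 ≤ p) (h1 : p ≤ 1) : |bern m q p - bern a q p| ≤ 4 * p := by
  have e1 := (abs_bern_sub_le m q h0 h1).trans (binE_abs_sub_le_two_mul (by omega) h0 h1)
  have e2 := (abs_bern_sub_le a q h0 h1).trans (binE_abs_sub_le_two_mul ha h0 h1)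
  rw [abs_le] at *
  constructor <;> linarith

/-- Cauchy–Schwarz over the support; the other terms vanish. -/
theorem sum_sqrt_div_le {k : ℕ} {p : Fin k → ℝ} (hp0 : ∀ i, 0 ≤ p i) (hp : ∑ i, p i = 1)
    {a : ℝ} (ha : 0 < a) : ∑ i, √(p i / a) ≤ √(supportSize p / a) := by
  classical
  set s : Finset (Fin k) := univ.filter fun i => 0 < p i with hs
  have hcard : (supportSize p : ℝ) = s.card := by
    rw [supportSize, ← Set.ncard_coe_finset]
    congr 2; ext i; simp [hs]
  have e : ∑ i, √(p i / a) = ∑ i ∈ s, 1 * √(p i / a) := by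
    rw [hs, sum_filter]
    refine sum_congr rfl fun i _ => ?_
    split_ifs with h
    · rw [one_mul]
    · rw [le_antisymm (not_lt.1 h) (hp0 i)]; simp
  rw [e, hcard]
  apply Real.le_sqrt_of_sq_le
  refine (sum_mul_sq_le_sq_mul_sq s (fun _ => 1) fun i => √(p i / a)).trans ?_
  have h1 : ∑ i ∈ s, √(p i / a) ^ 2 ≤ 1 / a := by
    rw [← hp, sum_div]
    calc _ = ∑ i ∈ s, p i / a := sum_congr rfl fun i _ => Real.sq_sqrt (div_nonneg (hp0 i) ha.le)
      _ ≤ _ := sum_le_sum_of_subset_of_nonneg (subset_univ _) fun i _ _ => div_nonneg (hp0 i) ha.le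
  calc _ ≤ (∑ i ∈ s, (1 : ℝ) ^ 2) * (1 / a) := by gcongr
    _ = _ := by simp [div_eq_mul_inv]

/-! ### Choice of parameters for large `n` -/

/-- With `x = log n`, this absorbs all logarithmic factors in the gap between `n ^ 0.008` and `n ^
0.01`. The cubic term of the exponential series forces `x` to be this large. -/
theorem exp_growth {x : ℝ} (hx : 10 ^ 12 ≤ x) :
    256 * x * (1 + x * Real.exp (0.008 * x)) ≤ Real.exp (0.01 * x) := by
  have h1 := Real.pow_div_factorial_le_exp (0.002 * x) (by linarith) 3
  have h2 : 512 * x ^ 2 ≤ Real.exp (0.002 * x) := by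
    refine le_trans ?_ h1
    rw [show Nat.factorial 3 = 6 from rfl, le_div_iff₀ (by norm_num)]
    have : 0 ≤ x ^ 2 := sq_nonneg x
    push_cast
    nlinarith [mul_le_mul_of_nonneg_left hx this]
  have h3 : 1 ≤ Real.exp (0.008 * x) := Real.one_le_exp (by linarith)
  have h4 : Real.exp (0.01 * x) = Real.exp (0.002 * x) * Real.exp (0.008 * x) := by
    rw [← Real.exp_add]; congr 1; ring
  rw [h4]
  calc _ ≤ 512 * x ^ 2 * Real.exp (0.008 * x) := by nlinarith
    _ ≤ _ := by gcongr

/-- A correction statistic that, used on the symbols with at most `1 / ε ^ 2` occurrences in a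
second block of samples, turns `bern a q` into `bern m q` up to the admissible error. -/
theorem exists_symbol_correction {a n m : ℕ} {q ε : ℝ} (hx : 10 ^ 12 ≤ Real.log n)
    (han : n ≤ 4 * a) (h2a : 2 * a ≤ n) (hε : 0 < ε) (hε1 : ε ≤ 1)
    (hεn : 1 ≤ ε ^ 2 * Real.log n) (hnm : n ≤ m) (hm : (m : ℝ) ≤ 2 * (ε ^ 2 * n * Real.log n))
    (hq : 0 ≤ q) :
    ∃ v : ℕ → ℝ, (∀ j, |v j| ≤ Real.exp (-0.99 * Real.log n)) ∧
      ∀ p, 0 ≤ p → p ≤ 1 →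
        |lowProb a p (1 / ε ^ 2) * binE a p v - (bern m q p - bern a q p)| ≤
          2048008 * min (ε * p) (√(p / a)) + Real.exp (-0.49 * Real.log n) * p := by
  set x := Real.log n with hxdef
  have hn0 : (0 : ℝ) < n := by
    rcases Nat.eq_zero_or_pos n with h | h
    · rw [h] at hxdef; simp at hxdef; rw [hxdef] at hx; norm_num at hx
    · exact_mod_cast h
  have hnexp : (n : ℝ) = Real.exp x := (Real.exp_log hn0).symm
  have g := exp_growth hx
  have hx0 : 0 < x := by linarith
  have han' : (n : ℝ) ≤ 4 * a := by exact_mod_cast han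
  have ha' : (0 : ℝ) < a := by linarith
  have ha : 0 < a := by exact_mod_cast ha'
  have hexp1 : 1 ≤ Real.exp (0.008 * x) := Real.one_le_exp (by linarith)
  have hxn : 256 * x ≤ n := by
    rw [hnexp]
    refine le_trans ?_ (g.trans (Real.exp_le_exp.2 (by linarith)))
    exact le_mul_of_one_le_right (by linarith) (by nlinarith)
  -- Degree proportional to `log n`: large enough for accuracy `O(ε)`, small enough that `28 ^ (2 *
  -- N) ≤ n ^ 0.008`.
  set N := ⌊x / 1000⌋₊ with hN
  have hN1 : 1 ≤ N := Nat.le_floor (by push_cast; linarith)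
  have hNle : (N : ℝ) ≤ x / 1000 := Nat.floor_le (by positivity)
  have hNge : x / 2000 ≤ N := by
    have h1 := Nat.lt_floor_add_one (x / 1000)
    have h2 : (1 : ℝ) ≤ N := by exact_mod_cast hN1
    rw [← hN] at h1
    linarith
  have hNpos : (0 : ℝ) < N := by exact_mod_cast hN1
  have hNa : 2 * N ≤ a := by
    have : (2 * N : ℝ) ≤ a := by linarith
    exact_mod_cast this
  have hm0 : 0 < m := by omega
  have hY : 2 * (N : ℝ) * 7 ^ (2 * N) * 4 ^ (2 * N) ≤ x * Real.exp (0.008 * x) := by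
    have h28 : (28 : ℝ) ^ (2 * N) ≤ Real.exp (0.008 * x) := by
      have h1 : (28 : ℝ) ≤ Real.exp 4 := by
        have := Real.exp_one_gt_d9
        rw [show (4 : ℝ) = (4 : ℕ) * 1 by norm_num, Real.exp_nat_mul]
        calc (28 : ℝ) ≤ 2.7 ^ 4 := by norm_num
          _ ≤ _ := pow_le_pow_left₀ (by norm_num) (by linarith) 4
      calc (28 : ℝ) ^ (2 * N) ≤ Real.exp 4 ^ (2 * N) := pow_le_pow_left₀ (by norm_num) h1 _
        _ = Real.exp ((2 * N : ℕ) * 4) := (Real.exp_nat_mul _ _).symm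
        _ ≤ _ := Real.exp_le_exp.2 (by push_cast; linarith)
    rw [mul_assoc, ← mul_pow, show (7 : ℝ) * 4 = 28 by norm_num]
    exact mul_le_mul (by linarith) h28 (by positivity) hx0.le
  obtain ⟨v, hv, hvp⟩ := exists_correction (q := q) (K := 16 * x) hN1 hNa hm0 (by linarith)
    (by linarith) hq
  have hvmax : ∀ j, |v j| ≤ Real.exp (-0.99 * x) := by
    intro j
    refine (hv j).trans ?_
    have e : Real.exp (-0.99 * x) = Real.exp (0.01 * x) / n := by
      rw [hnexp, ← Real.exp_sub]; congr 1; ring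
    rw [e, div_mul_eq_mul_div, div_le_div_iff₀ ha' hn0]
    calc 4 * (16 * x) * (1 + 2 * N * 7 ^ (2 * N) * 4 ^ (2 * N)) * n
        ≤ 4 * (16 * x) * (1 + x * Real.exp (0.008 * x)) * (4 * a) := by gcongr
      _ = 256 * x * (1 + x * Real.exp (0.008 * x)) * a := by ring
      _ ≤ _ := by gcongr
  have htail : 2 ^ (-(4 * (16 * x))) * Real.exp (16 * x) *
      (2 * (1 + 2 * N * 7 ^ (2 * N) * 2 ^ (2 * N))) ≤ Real.exp (-0.49 * x) := by
    have h1 : (2 : ℝ) ^ (-(4 * (16 * x))) ≤ Real.exp (-32 * x) := by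
      rw [Real.rpow_def_of_pos two_pos]
      have := mul_le_mul_of_nonneg_right Real.log_two_gt_d9.le hx0.le
      exact Real.exp_le_exp.2 (by linarith)
    have h2 : 2 * (1 + 2 * (N : ℝ) * 7 ^ (2 * N) * 2 ^ (2 * N)) ≤ Real.exp (0.01 * x) := by
      refine le_trans ?_ g
      have h3 : 2 * (N : ℝ) * 7 ^ (2 * N) * 2 ^ (2 * N) ≤ x * Real.exp (0.008 * x) := by
        refine le_trans ?_ hY
        gcongr; norm_num
      exact mul_le_mul (by linarith) (by linarith) (by positivity) (by linarith)
    calc _ ≤ Real.exp (-32 * x) * Real.exp (16 * x) * Real.exp (0.01 * x) := by gcongr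
      _ = Real.exp (-32 * x + 16 * x + 0.01 * x) := by rw [Real.exp_add, Real.exp_add]
      _ ≤ _ := Real.exp_le_exp.2 (by linarith)
  -- The roots multiply to at most `16 * ε * x`, and `x ≤ 2000 * N`; `4 * 16 * 2000 = 128000`.
  have hC : 4 * √(2 * m) * √(16 * x / a) / N ≤ 128000 * ε := by
    have h1 : √(2 * (m : ℝ)) * √(16 * x / a) ≤ 16 * (ε * x) := by
      rw [← Real.sqrt_mul (by positivity)]
      refine Real.sqrt_le_iff.2 ⟨by positivity, ?_⟩
      rw [mul_div_assoc', div_le_iff₀ ha']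
      calc 2 * (m : ℝ) * (16 * x) ≤ 2 * (2 * (ε ^ 2 * (4 * a) * x)) * (16 * x) := by
            have : ε ^ 2 * n * x ≤ ε ^ 2 * (4 * a) * x := by gcongr
            gcongr
            linarith
        _ = _ := by ring
    rw [div_le_iff₀ hNpos]
    have h2 : ε * x ≤ ε * (2000 * N) := by
      gcongr
      linarith
    linarith
  refine ⟨v, hvmax, fun p hp hp1 => ?_⟩
  set w := √(a * p) with hw
  set s := √(p / a) with hs
  have hw2 : w ^ 2 = a * p := Real.sq_sqrt (by positivity)
  have hws : w * s = p := by
    rw [hw, hs, ← Real.sqrt_mul (by positivity), show a * p * (p / a) = p ^ 2 by field_simp,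
      Real.sqrt_sq hp]
  have hX1 := abs_bern_sub_bern_le_sqrt (m := m) ha (by omega) q hp hp1
  have hX2 := abs_bern_sub_bern_le_mul (m := m) ha (by omega) q hp hp1
  have hπ := lowProb_le (a := a) (1 / ε ^ 2) hp hp1
  have hπ0 := lowProb_nonneg (a := a) (1 / ε ^ 2) hp hp1
  have hρ : 0 ≤ Real.exp (-0.49 * x) * p := by positivity
  -- Above `16 * x / a` the polynomial approximation says nothing, but the threshold `1 / ε ^ 2` is
  -- at most `x`, so the correction is on with probability at most `n ^ (-7)`.
  rcases le_or_gt p (16 * x / a) with hpB | hpB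
  · have hV := hvp p hp hpB
    have hV' : |binE a p v - (bern m q p - bern a q p)| ≤
        128000 * (ε * (w * s)) + Real.exp (-0.49 * x) * p := by
      rw [hws]
      refine hV.trans (add_le_add ?_ (mul_le_mul_of_nonneg_right htail hp))
      rw [← mul_assoc]
      exact mul_le_mul_of_nonneg_right hC hp
    have := abs_mixture_le hε hε1 (Real.sqrt_nonneg (a * p)) (Real.sqrt_nonneg (p / a)) hπ0
      (lowProb_le_one (a := a) _ hp hp1) (by rw [hw2]; exact hπ)
      (by rw [hw2]; exact one_sub_lowProb_le _ hp hp1) hX1 (by rw [hws]; exact hX2)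
      (by norm_num) hρ hV'
    rw [hws] at this
    rwa [show (16 * 128000 + 8 : ℝ) = 2048008 by norm_num] at this
  · have hap : 16 * x ≤ a * p := by
      rw [div_lt_iff₀ ha'] at hpB; linarith
    have hεw : 1 ≤ ε * w := by
      have : 1 ≤ (ε * w) ^ 2 := by
        rw [mul_pow, hw2]
        have := mul_le_mul_of_nonneg_left hap (sq_nonneg ε)
        linarith
      by_contra! hlt
      have h0 : 0 ≤ ε * w := mul_nonneg hε.le (Real.sqrt_nonneg _)
      exact absurd (pow_lt_one₀ h0 hlt two_ne_zero) (not_lt.2 this)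
    have hsp : s ≤ ε * p := by
      rw [← hws, ← mul_assoc]
      exact le_mul_of_one_le_left (Real.sqrt_nonneg _) hεw
    rw [min_eq_right hsp]
    have hT : 1 / ε ^ 2 ≤ x := by
      rw [div_le_iff₀ (by positivity)]; linarith
    have hπ' : lowProb a p (1 / ε ^ 2) ≤ Real.exp (-7 * x) := by
      refine hπ.trans ?_
      rw [Real.rpow_def_of_pos two_pos, ← Real.exp_add]
      have h1 : Real.log 2 * (1 / ε ^ 2) ≤ 1 * x :=
        mul_le_mul (by linarith [Real.log_two_lt_d9]) hT (by positivity) (by norm_num)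
      exact Real.exp_le_exp.2 (by linarith)
    have hVmax : |binE a p v| ≤ Real.exp (-0.99 * x) := abs_binE_le_of_abs_le hp hp1 hvmax
    have hpn : Real.exp (-x) ≤ p := by
      rw [Real.exp_neg, ← hnexp]
      refine le_trans ?_ hpB.le
      rw [inv_eq_one_div, div_le_div_iff₀ hn0 ha']
      have h2a' : 2 * (a : ℝ) ≤ n := by exact_mod_cast h2a
      have : 1 * (n : ℝ) ≤ 16 * x * n := mul_le_mul_of_nonneg_right (by linarith) hn0.le
      linarith
    have h1 : |lowProb a p (1 / ε ^ 2) * binE a p v| ≤ Real.exp (-0.49 * x) * p := by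
      rw [abs_mul, abs_of_nonneg hπ0]
      calc _ ≤ Real.exp (-7 * x) * Real.exp (-0.99 * x) :=
            mul_le_mul hπ' hVmax (abs_nonneg _) (by positivity)
        _ ≤ Real.exp (-0.49 * x) * Real.exp (-x) := by
            rw [← Real.exp_add, ← Real.exp_add]
            exact Real.exp_le_exp.2 (by linarith)
        _ ≤ _ := by gcongr
    have hs0 : 0 ≤ s := Real.sqrt_nonneg _
    refine (abs_sub _ _).trans ?_
    linarith

/-- The estimator for large `n`: two blocks of `n / 2` samples, the second of which decides where
the empirical estimator on the first one is corrected. -/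
theorem exists_estimator_of_large {k n m : ℕ} {q : Fin k → ℝ} {ε : ℝ}
    (hx : 10 ^ 12 ≤ Real.log n) (hε : 0 < ε) (hε1 : ε ≤ 1)
    (hεn : 1 ≤ ε ^ 2 * Real.log n) (hnm : n ≤ m) (hm : (m : ℝ) ≤ 2 * (ε ^ 2 * n * Real.log n))
    (hq : ∀ i, 0 ≤ q i) :
    ∃ Dhat : (Fin n → Fin k) → ℝ, ∀ p : Fin k → ℝ, p ∈ stdSimplex ℝ (Fin k) →
      mae Dhat (l1Dist q) p ≤ mae (l1Empirical q m) (l1Dist q) p +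
        5000000 * min ε (√((supportSize p : ℝ) / n) + Real.exp (-0.49 * Real.log n)) := by
  -- `d` is the parity of `n`: one sample is discarded when `n` is odd.
  obtain ⟨a, d, hnad, hd⟩ : ∃ a d, n = a + a + d ∧ d < 2 :=
    ⟨n / 2, n % 2, by omega, by omega⟩
  have hn2 : 2 ≤ n := by
    by_contra! h
    interval_cases n <;> norm_num at hx
  have han : n ≤ 4 * a := by omega
  have h2a : 2 * a ≤ n := by omega
  have ha : 0 < a := by omega
  have hn0 : (0 : ℝ) < n := by exact_mod_cast (by omega : 0 < n)
  have hnexp : (n : ℝ) = Real.exp (Real.log n) := (Real.exp_log hn0).symm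
  choose v hv hvp using fun i => exists_symbol_correction (q := q i) hx han h2a hε hε1 hεn hnm hm
    (hq i)
  set x := Real.log n with hxdef
  have ha' : (0 : ℝ) < a := by exact_mod_cast ha
  have han' : (n : ℝ) ≤ 4 * a := by exact_mod_cast han
  have hx0 : 0 < x := by linarith
  set T := 1 / ε ^ 2
  set vmax := Real.exp (-0.99 * x) with hvmax
  set ρ := Real.exp (-0.49 * x) with hρ
  have hρ0 : 0 < ρ := Real.exp_pos _
  set ψ : Fin k → ℕ → ℕ → ℝ := fun i s t =>
    |(s : ℝ) / a - q i| + v i s * (if (t : ℝ) ≤ T then 1 else 0) with hψ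
  have hψΔ : ∀ i s s' t t', s ≤ s' + 1 → s' ≤ s + 1 →
      |ψ i s t - ψ i s' t'| ≤ 1 / a + 2 * vmax := by
    intro i s s' t t' h1 h2
    have hsv : ∀ (s t : ℕ), |v i s * (if (t : ℝ) ≤ T then 1 else 0)| ≤ vmax := by
      intro s t
      split_ifs
      · rw [mul_one]; exact hv i s
      · rw [mul_zero, abs_zero]; positivity
    have hemp : |(|(s : ℝ) / a - q i| - |(s' : ℝ) / a - q i|)| ≤ 1 / a := by
      refine (abs_abs_sub_abs_le _ _).trans ?_
      rw [show (s : ℝ) / a - q i - ((s' : ℝ) / a - q i) = (s - s') / a by ring, abs_div,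
        abs_of_pos ha']
      gcongr
      have h1' : (s : ℝ) ≤ s' + 1 := by exact_mod_cast h1
      have h2' : (s' : ℝ) ≤ s + 1 := by exact_mod_cast h2
      rw [abs_le]; constructor <;> linarith
    have e1 := hsv s t
    have e2 := hsv s' t'
    simp only [hψ]
    rw [abs_le] at *
    constructor <;> linarith
  subst hnad
  refine ⟨blockEst a d ψ, fun p hp => ?_⟩
  have hp0 : ∀ i, 0 ≤ p i := hp.1
  have hp1 : ∑ i, p i = 1 := hp.2
  have hple : ∀ i, p i ≤ 1 := fun i => by
    rw [← hp1]; exact single_le_sum (fun j _ => hp0 j) (mem_univ i)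
  refine (mae_le_mae_l1Empirical_add (m := m) (q := q) hp0 hp1 (by positivity) _
    (abs_blockEst_update_le ha hψΔ)).trans ?_
  have hfluct : √((a + a + d : ℕ) : ℝ) * (2 * (1 / a + 2 * vmax)) ≤ 12 * ρ := by
    have h1 : √((a + a + d : ℕ) : ℝ) = Real.exp (x / 2) := by
      rw [Real.exp_half, ← hnexp]
    have h2 : 1 / (a : ℝ) ≤ 4 * Real.exp (-x) := by
      rw [Real.exp_neg, ← hnexp, ← div_eq_mul_inv, div_le_div_iff₀ ha' hn0]; linarith
    have h3 : Real.exp (x / 2) * Real.exp (-x) ≤ ρ := by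
      rw [← Real.exp_add]; exact Real.exp_le_exp.2 (by linarith)
    have h4 : Real.exp (x / 2) * vmax = ρ := by
      rw [hvmax, hρ, ← Real.exp_add]; congr 1; ring
    rw [h1]
    have h5 := mul_le_mul_of_nonneg_left h2 (Real.exp_pos (x / 2)).le
    linarith
  have hbias : |expct p (blockEst a d ψ) - ∑ i, bern m (q i) (p i)| ≤
      2048008 * min ε (√((supportSize p : ℝ) / a)) + ρ := by
    rw [expct_blockEst hp1, ← sum_sub_distrib]
    have hterm : ∀ i, |binE a (p i) (fun s => binE a (p i) (fun t => ψ i s t)) -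
        bern m (q i) (p i)| ≤ 2048008 * min (ε * p i) (√(p i / a)) + ρ * p i := by
      intro i
      have e : binE a (p i) (fun s => binE a (p i) (fun t => ψ i s t)) =
          bern a (q i) (p i) + lowProb a (p i) T * binE a (p i) (v i) := by
        simp only [hψ, binE_add, binE_const, binE_const_mul]
        rw [bern, lowProb, ← binE_const_mul]
        congr 2; ext s; ring
      have e2 : bern a (q i) (p i) + lowProb a (p i) T * binE a (p i) (v i) - bern m (q i) (p i) =
          lowProb a (p i) T * binE a (p i) (v i) - (bern m (q i) (p i) - bern a (q i) (p i)) := by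
        ring
      rw [e, e2]
      exact hvp i (p i) (hp0 i) (hple i)
    refine (abs_sum_le_sum_abs _ _).trans ((sum_le_sum fun i _ => hterm i).trans ?_)
    rw [sum_add_distrib, ← mul_sum, ← mul_sum, hp1, mul_one]
    have h1 : ∑ i, min (ε * p i) (√(p i / a)) ≤ ε := by
      refine (sum_le_sum fun i _ => min_le_left _ _).trans (le_of_eq ?_)
      rw [← mul_sum, hp1, mul_one]
    have h2 : ∑ i, min (ε * p i) (√(p i / a)) ≤ √((supportSize p : ℝ) / a) :=
      (sum_le_sum fun i _ => min_le_right _ _).trans (sum_sqrt_div_le hp0 hp1 ha')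
    have := le_min h1 h2
    linarith
  set S : ℝ := (supportSize p : ℝ) with hS
  have hS0 : 0 ≤ S := Nat.cast_nonneg _
  have hsq : √(S / a) ≤ 2 * √(S / (a + a + d : ℕ)) := by
    rw [show (2 : ℝ) = √4 by rw [show (4 : ℝ) = 2 ^ 2 by norm_num, Real.sqrt_sq two_pos.le],
      ← Real.sqrt_mul (by norm_num)]
    apply Real.sqrt_le_sqrt
    rw [mul_div_assoc', div_le_div_iff₀ ha' hn0]
    have := mul_le_mul_of_nonneg_left han' hS0
    linarith
  -- `ρ ^ 2 = n ^ (-0.98)` is below `1 / log n`, hence below `ε ^ 2`. This lets the fluctuation term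
  -- go inside the minimum.
  have hρε : ρ ≤ ε := by
    have g := exp_growth hx
    have h1 : x ≤ Real.exp (0.98 * x) := by
      have := Real.one_le_exp (show 0 ≤ 0.008 * x by linarith)
      have h2 : x ≤ 256 * x * (1 + x * Real.exp (0.008 * x)) := by
        have : x * 1 ≤ 256 * x * (1 + x * Real.exp (0.008 * x)) :=
          mul_le_mul (by linarith) (by nlinarith) (by norm_num) (by linarith)
        linarith
      exact h2.trans (g.trans (Real.exp_le_exp.2 (by linarith)))
    have h2 : ρ ^ 2 * Real.exp (0.98 * x) = 1 := by
      rw [hρ, ← Real.exp_nat_mul, ← Real.exp_add, Real.exp_eq_one_iff]; push_cast; ring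
    have h3 : ρ ^ 2 ≤ ε ^ 2 := by
      have h4 : ρ ^ 2 * x ≤ ε ^ 2 * x := by
        refine le_trans ?_ hεn
        rw [← h2]; gcongr
      exact le_of_mul_le_mul_right h4 hx0
    exact (abs_le_of_sq_le_sq' h3 hε.le).2
  have hfin : 2048008 * min ε (√(S / a)) + 13 * ρ ≤
      5000000 * min ε (√(S / (a + a + d : ℕ)) + ρ) := by
    have hmin : min ε (√(S / a)) ≤ 2 * min ε (√(S / (a + a + d : ℕ)) + ρ) := by
      rcases min_cases ε (√(S / (a + a + d : ℕ)) + ρ) with ⟨h, _⟩ | ⟨h, _⟩ <;> rw [h]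
      · exact (min_le_left _ _).trans (by linarith)
      · exact (min_le_right _ _).trans (by linarith)
    have hmin2 : ρ ≤ min ε (√(S / (a + a + d : ℕ)) + ρ) :=
      le_min hρε (by linarith [Real.sqrt_nonneg (S / (a + a + d : ℕ))])
    linarith
  linarith

/-! ### Remaining regimes and conclusion -/

/-- With at least as many samples as the empirical estimator, the latter can be used on a prefix. -/
theorem exists_estimator_of_le {k n m : ℕ} (q : Fin k → ℝ) (h : m ≤ n) :
    ∃ Dhat : (Fin n → Fin k) → ℝ, ∀ p : Fin k → ℝ, p ∈ stdSimplex ℝ (Fin k) →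
      mae Dhat (l1Dist q) p = mae (l1Empirical q m) (l1Dist q) p := by
  obtain ⟨d, rfl⟩ := Nat.exists_eq_add_of_le h
  refine ⟨fun x => l1Empirical q m (fun j => x (Fin.castAdd d j)), fun p hp => ?_⟩
  rw [mae_eq_expct, mae_eq_expct]
  exact expct_castAdd hp.2 (fun y => |l1Empirical q m y - l1Dist q p|)

theorem mae_zero_le_two {k n : ℕ} {p q : Fin k → ℝ} (hq : q ∈ stdSimplex ℝ (Fin k))
    (hp : p ∈ stdSimplex ℝ (Fin k)) :
    mae (fun _ : Fin n → Fin k => 0) (l1Dist q) p ≤ 2 := by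
  rw [mae_eq_expct, expct_const hp.2, zero_sub, abs_neg]
  have h : l1Dist q p ≤ 2 := by
    have h1 : ∀ i, |p i - q i| ≤ p i + q i := fun i => by
      have := hp.1 i
      have := hq.1 i
      rw [abs_le]; constructor <;> linarith
    refine (sum_le_sum fun i _ => h1 i).trans ?_
    rw [sum_add_distrib, hp.2, hq.2]; norm_num
  rwa [abs_of_nonneg (sum_nonneg fun i _ => abs_nonneg _)]

theorem mae_nonneg {k n : ℕ} {p : Fin k → ℝ} (hp : ∀ i, 0 ≤ p i) (Fhat : (Fin n → Fin k) → ℝ)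
    (F : (Fin k → ℝ) → ℝ) : 0 ≤ mae Fhat F p :=
  sum_nonneg fun _ _ => mul_nonneg (prod_nonneg fun _ _ => hp _) (abs_nonneg _)

end L1Amp

theorem theorem2 :
    ∃ c : ℝ, 0 < c ∧
      ∀ (k : ℕ) (q : Fin k → ℝ), q ∈ stdSimplex ℝ (Fin k) →
      ∀ (ε : ℝ), 0 < ε → ε ≤ 1 →
      ∀ (n : ℕ), 1 ≤ n →
      ∀ (m : ℕ), (m = ⌊ε ^ 2 * (n : ℝ) * Real.log n⌋₊ ∨ m = ⌈ε ^ 2 * (n : ℝ) * Real.log n⌉₊) →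
      ∃ Dhat : (Fin n → Fin k) → ℝ,
        ∀ p : Fin k → ℝ, p ∈ stdSimplex ℝ (Fin k) →
          L1Amp.mae Dhat (L1Amp.l1Dist q) p ≤
            L1Amp.mae (L1Amp.l1Empirical q m) (L1Amp.l1Dist q) p +
              c * min ε (Real.sqrt ((L1Amp.supportSize p : ℝ) / (n : ℝ)) +
                1 / (n : ℝ) ^ (0.49 : ℝ)) := by
  -- The first summand serves large `n`. The second covers `log n < 10 ^ 12`, where the zero
  -- estimator errs by at most `2` and the minimum is at least `exp (-(10 ^ 12))`.
  refine ⟨5000000 + 2 * Real.exp (10 ^ 12), by positivity, ?_⟩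
  intro k q hq ε hε hε1 n hn m hm
  have hn0 : (0 : ℝ) < n := by exact_mod_cast hn
  have hρ : 1 / (n : ℝ) ^ (0.49 : ℝ) = Real.exp (-0.49 * Real.log n) := by
    rw [Real.rpow_def_of_pos hn0, one_div, ← Real.exp_neg]; congr 1; ring
  simp only [hρ]
  have hmin0 : ∀ S : ℕ, 0 ≤ min ε (√((S : ℝ) / n) + Real.exp (-0.49 * Real.log n)) :=
    fun S => le_min hε.le (by positivity)
  have hE := Real.exp_pos (10 ^ 12)
  rcases le_or_gt m n with hmn | hmn
  · obtain ⟨D, hD⟩ := L1Amp.exists_estimator_of_le q hmn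
    refine ⟨D, fun p hp => ?_⟩
    rw [hD p hp]
    exact le_add_of_nonneg_right (mul_nonneg (by positivity) (hmin0 _))
  have hlog0 : 0 ≤ Real.log n := Real.log_nonneg (by exact_mod_cast hn)
  have hy0 : 0 ≤ ε ^ 2 * (n : ℝ) * Real.log n := by positivity
  have hny : (n : ℝ) ≤ ε ^ 2 * (n : ℝ) * Real.log n := by
    rcases hm with h | h
    · have h1 := Nat.floor_le hy0
      rw [← h] at h1
      exact le_trans (by exact_mod_cast hmn.le) h1
    · rw [h, Nat.lt_ceil] at hmn
      exact hmn.le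
  -- Rounding up adds less than `1`, and `1 ≤ n ≤ ε ^ 2 * n * log n` when `n < m`.
  have hmy : (m : ℝ) ≤ 2 * (ε ^ 2 * (n : ℝ) * Real.log n) := by
    have h1 : (1 : ℝ) ≤ n := by exact_mod_cast hn
    rcases hm with h | h
    · have h2 := Nat.floor_le hy0
      rw [← h] at h2
      linarith
    · have h2 := Nat.ceil_lt_add_one hy0
      rw [← h] at h2
      linarith
  have hεn : 1 ≤ ε ^ 2 * Real.log n := by
    have : 1 * (n : ℝ) ≤ ε ^ 2 * Real.log n * n := by linarith
    exact le_of_mul_le_mul_right this hn0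
  rcases le_or_gt (10 ^ 12) (Real.log n) with hx | hx
  · obtain ⟨D, hD⟩ := L1Amp.exists_estimator_of_large hx hε hε1 hεn hmn.le hmy hq.1
    refine ⟨D, fun p hp => (hD p hp).trans ?_⟩
    have := hmin0 (L1Amp.supportSize p)
    gcongr
    linarith
  · refine ⟨fun _ => 0, fun p hp => (L1Amp.mae_zero_le_two hq hp).trans ?_⟩
    have h1 : Real.exp (-(10 ^ 12)) ≤ ε := by
      have h2 : Real.exp (-(10 ^ 12)) ≤ 1 / 10 ^ 12 := by
        rw [Real.exp_neg, inv_eq_one_div]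
        gcongr
        linarith [Real.add_one_le_exp ((10 : ℝ) ^ 12)]
      have h3 : 1 ≤ ε * 10 ^ 12 := by
        have : ε ^ 2 ≤ ε := by nlinarith
        calc 1 ≤ ε ^ 2 * Real.log n := hεn
          _ ≤ ε * 10 ^ 12 := mul_le_mul this hx.le hlog0 hε.le
      refine h2.trans ?_
      rw [div_le_iff₀ (by norm_num)]; exact h3
    have h4 : Real.exp (-(10 ^ 12)) ≤ √((L1Amp.supportSize p : ℝ) / n) +
        Real.exp (-0.49 * Real.log n) := by
      have h5 : Real.exp (-(10 ^ 12)) ≤ Real.exp (-0.49 * Real.log n) :=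
        Real.exp_le_exp.2 (by linarith)
      linarith [Real.sqrt_nonneg ((L1Amp.supportSize p : ℝ) / n)]
    have h6 := le_min h1 h4
    have h7 := L1Amp.mae_nonneg hp.1 (L1Amp.l1Empirical q m) (L1Amp.l1Dist q)
    have h8 : Real.exp (10 ^ 12) * Real.exp (-(10 ^ 12)) = 1 := by
      rw [← Real.exp_add, add_neg_cancel, Real.exp_zero]
    have h9 := mul_le_mul_of_nonneg_left h6 hE.le
    rw [h8] at h9
    have h10 := hmin0 (L1Amp.supportSize p)
    rw [add_mul, mul_assoc]
    linarith
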